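/- Let $d>2$ be an integer, $\sigma>0$ and $L\ge 0$. There is a constant $c_u>0$ depending only on $d$, $\sigma$ and $L$ such that the following holds for every $n\ge 1$, every choice of fixed design points $x_1,\dots,x_n\in[0,1]^d$ and every function $f^*:[0,1]^d\to\mathbb{R}$ that is $L$-Lipschitz for the Euclidean norm. Let $y_i=f^*(x_i)+\varepsilon_i$, $i=1,\dots,n$, where $\varepsilon_1,\dots,\varepsilon_n$ are i.i.d. $\mathcal N(0,\sigma^2)$, and put $Y=(y_1,\dots,y_n)^\top$ and $\|h\|_n^2=\frac1n\sum_{i=1}^n h(x_i)^2$ (similarly $\|v\|_n^2=\frac1n\sum_i v_i^2$ for $v\in\mathbb R^n$). For $k=1,\dots,n$ let $\mathcal N_k(i)$ be the set of indices of the $k$ nearest neighbours of $x_i$ among $x_1,\dots,x_n$ in the Euclidean norm, where $x_i$ is its own first neighbour and all other ties in the list of neighbours of $x_i$ are broken by an order of the indices $\{1,\dots,n\}$ attached to $i$ (the same for all $k$). Let $A_k\in\mathbb{R}^{n\times n}$ have entries $(A_k)_{ij}=1/k$ if $j\in\mathcal N_k(i)$ and $0$ otherwise, let $f^k(x_i)=(A_kY)_i$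 be the $k$-nearest-neighbour estimator, $R_k=\|(I_n-A_k)Y\|_n^2$ its empirical risk, and $$k^\tau=\sup\{k\in\{1,\dots,n\} : R_k\le\sigma^2\}$$ the minimum discrepancy stopping rule. Then $\|f^{k^\tau}-f^*\|_n^2$ is integrable with respect to the noise for every choice of the tie-breaking orders, and: (a) if the tie-breaking orders are random, uniform, independent for different $i$ and independent of the noise, then $$\mathbb{E}\,\|f^{k^\tau}-f^*\|_n^2\le c_u\,n^{-\frac{2}{2+d}},$$ where $\mathbb{E}$ is the expectation over the noise and the tie-breaking (if there are no ties, this is the expectation $\mathbb E_\varepsilon$ over the noise); (b) if $x_1,\dots,x_n$ are pairwise distinct, then, for every fixed choice of the tie-breaking orders, $$\mathbb{E}_\varepsilon\|f^{k^\tau}-f^*\|_n^2\le c_u\,n^{-\frac{2}{2+d}}.$$ -/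

import Mathlib

open MeasureTheory ProbabilityTheory
open scoped NNReal Matrix

noncomputable section

namespace KNN

/-- The unit cube `[0,1]^d` in Euclidean space. -/
def cube (d : ℕ) : Set (EuclideanSpace ℝ (Fin d)) := {x | ∀ a, x a ∈ Set.Icc (0 : ℝ) 1}

/-- A realization of the tie-breaking: for every `i`, an order of the `n` indices, which is
consulted only between design points at the same distance from the `i`-th one. -/
abbrev Ties (n : ℕ) : Type := Fin n → Equiv.Perm (Fin n)

variable {d n : ℕ}

/-- `x j` comes before `x l` in the list of neighbours of `x i`: it is strictly closer in the
Euclidean distance, or the distances are equal and the tie is broken in favour of `j`. The point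
`x i` is always its own first neighbour, other ties are broken by the order `τ i`. -/
def Precedes (x : Fin n → EuclideanSpace ℝ (Fin d)) (τ : Ties n) (i j l : Fin n) : Prop :=
  dist (x i) (x j) < dist (x i) (x l) ∨
    (dist (x i) (x j) = dist (x i) (x l) ∧ l ≠ i ∧ (j = i ∨ τ i j < τ i l))

open Classical in
/-- The set `𝒩_k(i)` of the indices of the `k` nearest neighbours of `x i`: those preceded by fewer
than `k` indices. -/
def nbrs (x : Fin n → EuclideanSpace ℝ (Fin d)) (τ : Ties n) (k : ℕ) (i : Fin n) :
    Finset (Fin n) :=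
  {j | (Finset.univ.filter fun l => Precedes x τ i l j).card < k}

/-- The matrix `A_k` of the `k`-nearest-neighbour estimator. -/
def smoother (x : Fin n → EuclideanSpace ℝ (Fin d)) (τ : Ties n) (k : ℕ) :
    Matrix (Fin n) (Fin n) ℝ :=
  Matrix.of fun i j => if j ∈ nbrs x τ k i then 1 / (k : ℝ) else 0

/-- The `k`-nearest-neighbour estimator at the design points, `F^k = A_k Y`. -/
def est (x : Fin n → EuclideanSpace ℝ (Fin d)) (τ : Ties n) (k : ℕ) (Y : Fin n → ℝ) :
    Fin n → ℝ :=
  smoother x τ k *ᵥ Y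

/-- The squared empirical norm of a function given by its values at the design points. -/
def empNormSq (v : Fin n → ℝ) : ℝ := (1 / (n : ℝ)) * ∑ i, v i ^ 2

/-- The empirical risk `R_k = ‖(I - A_k) Y‖_n²`. -/
def empRisk (x : Fin n → EuclideanSpace ℝ (Fin d)) (τ : Ties n) (k : ℕ) (Y : Fin n → ℝ) : ℝ :=
  empNormSq ((1 - smoother x τ k) *ᵥ Y)

/-- The minimum discrepancy stopping rule `k^τ = sup {k ∈ {1, …, n} | R_k ≤ σ²}`. -/
def minDiscrepancy (x : Fin n → EuclideanSpace ℝ (Fin d)) (τ : Ties n) (σ : ℝ) (Y : Fin n → ℝ) :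
    ℕ :=
  sSup {k : ℕ | 1 ≤ k ∧ k ≤ n ∧ empRisk x τ k Y ≤ σ ^ 2}

/-- The law of the noise vector: i.i.d. centred Gaussian coordinates with variance `σ²`. -/
def noise (n : ℕ) (σ : ℝ) : Measure (Fin n → ℝ) :=
  Measure.pi fun _ => gaussianReal 0 ⟨σ ^ 2, sq_nonneg σ⟩

/-- The vector of responses `y_i = f(x_i) + ε_i`. -/
def response (x : Fin n → EuclideanSpace ℝ (Fin d)) (f : EuclideanSpace ℝ (Fin d) → ℝ)
    (ε : Fin n → ℝ) : Fin n → ℝ :=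
  fun i => f (x i) + ε i

/-- The error `‖f^{k^τ} - f‖_n²` of the `k`-nearest-neighbour estimator stopped by the minimum
discrepancy rule, as a function of the noise. -/
def loss (x : Fin n → EuclideanSpace ℝ (Fin d)) (τ : Ties n) (σ : ℝ)
    (f : EuclideanSpace ℝ (Fin d) → ℝ) (ε : Fin n → ℝ) : ℝ :=
  empNormSq fun i =>
    est x τ (minDiscrepancy x τ σ (response x f ε)) (response x f ε) i - f (x i)

end KNN

end

/-!
Write `A` for the smoother at `k`, `b` for the error of the estimator without noise, and `‖·‖`,
`⟨·,·⟩` for the empirical norm and inner product. The error is `b + A ε`, and expanding the risk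
gives

  `R_k = ‖b + A ε‖² + ‖ε‖² - 2 ⟨b, ε⟩ - 2 ⟨A ε, ε⟩`   (`empRisk_eq`).

Every point is its own neighbour, so `⟨A ε, ε⟩` and `‖A ε‖²` both have mean `σ² / k`, and the
expected risk at `k` is `σ² + ‖b‖² - σ² / k`: the rule stops where squared bias and variance cross.

*Upper bound at the stopping time.* As `R_k ≤ σ²` there, the identity bounds the loss by
`2 σ² / k` plus the fluctuations of `‖ε‖²`, `⟨A ε, ε⟩` and `⟨b, ε⟩` (`loss_le`). These have to be
controlled uniformly in `k`. The variance of `⟨A ε, ε⟩` is of order `1 / (n k)`, which has a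
logarithmic sum over `k`, and `⟨b, ε⟩` is Gaussian with variance of order `1 / n`. All in all they
contribute `log n / √n`, which is negligible because `d > 2`.

*The stopping time is not too small.* Take one fixed `k` of order `n ^ (2 / (2 + d))` at which the
squared bias is a small fraction of the variance (`exists_balanced`). The rule stops no earlier than
`k` unless `R_k > σ²`. This event forces a fluctuation of the order of `σ² / k` in
`‖A ε‖²`, `⟨A ε, ε⟩`, `⟨b, ε⟩` or `‖ε‖²` (`one_le_failureBound`). Chebyshev's inequality handles
the first three. For the last one it is too weak in dimension three, and an exponential moment
replaces it.

*Ingredients.* The variance of `‖A ε‖²` involves the squared numbers of points that have `j` among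
their `k` nearest neighbours. A cone covering argument bounds the points away from `x j` that do so,
and the random tie-breaking bounds the points at the same location
(`exists_sum_reverseCount_sq_le`). The squared bias for a fixed design is bounded by counting the
points in sparsely populated dyadic cells; the sum over scales is geometric when `d > 2`
(`sum_sq_biasVec_le`).
-/

noncomputable section

namespace KNN

/-! ### Nearest neighbours and reverse nearest neighbours -/

section

/-- For an injective key, exactly `k` elements have rank less than `k`. -/
theorem card_filter_card_lt_lt {ι α : Type*} [Fintype ι] [LinearOrder α] {g : ι → α}
    (hg : Function.Injective g) {k : ℕ} (hk : k ≤ Fintype.card ι) :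
    (Finset.univ.filter fun j => (Finset.univ.filter fun l => g l < g j).card < k).card = k := by
  classical
  set r : ι → ℕ := fun j => (Finset.univ.filter fun l => g l < g j).card with hr
  have hmono : ∀ j l, g j < g l → r j < r l := by
    intro j l hjl
    refine Finset.card_lt_card ⟨fun a ha => ?_, fun h => ?_⟩
    · simp only [Finset.mem_filter, Finset.mem_univ, true_and] at ha ⊢
      exact ha.trans hjl
    · have := h (Finset.mem_filter.2 ⟨Finset.mem_univ j, hjl⟩)
      simp at this
  have hinj : Function.Injective r := by
    intro j l h
    by_contra hne
    rcases lt_or_gt_of_ne (fun e => hne (hg e)) with h' | h'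
    · exact absurd h (hmono _ _ h').ne
    · exact absurd h (hmono _ _ h').ne'
  have hlt : ∀ j, r j < Fintype.card ι := by
    intro j
    refine Finset.card_lt_univ_of_notMem (x := j) ?_
    simp
  have himg : Finset.univ.image r = Finset.range (Fintype.card ι) := by
    refine Finset.eq_of_subset_of_card_le (fun a ha => ?_) ?_
    · obtain ⟨j, -, rfl⟩ := Finset.mem_image.1 ha
      exact Finset.mem_range.2 (hlt j)
    · rw [Finset.card_image_of_injective _ hinj, Finset.card_range, Finset.card_univ]
  have : (Finset.univ.filter fun j => r j < k).image r = Finset.range k := by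
    ext a
    simp only [Finset.mem_image, Finset.mem_filter, Finset.mem_univ, true_and, Finset.mem_range]
    constructor
    · rintro ⟨j, hj, rfl⟩; exact hj
    · intro ha
      have : a ∈ Finset.univ.image r := by rw [himg]; exact Finset.mem_range.2 (ha.trans_le hk)
      obtain ⟨j, -, rfl⟩ := Finset.mem_image.1 this
      exact ⟨j, ha, rfl⟩
  rw [← Finset.card_image_of_injective _ hinj, this, Finset.card_range]

variable {d n : ℕ} (x : Fin n → EuclideanSpace ℝ (Fin d)) (τ : Ties n)

/-- The sort key of the `j`-th design point in the list of neighbours of the `i`-th one: the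
distance first, then `0` for the point itself and the tie-breaking position, shifted by one, for
the others. -/
def neighbourKey (i j : Fin n) : ℝ ×ₗ ℕ :=
  toLex (dist (x i) (x j), if j = i then 0 else (τ i j : ℕ) + 1)

theorem precedes_iff_neighbourKey_lt (i j l : Fin n) :
    Precedes x τ i j l ↔ neighbourKey x τ i j < neighbourKey x τ i l := by
  unfold Precedes neighbourKey
  rw [Prod.Lex.toLex_lt_toLex]
  have : (l ≠ i ∧ (j = i ∨ τ i j < τ i l)) ↔
      (if j = i then 0 else (τ i j : ℕ) + 1) < (if l = i then 0 else (τ i l : ℕ) + 1) := by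
    by_cases hl : l = i <;> by_cases hj : j = i <;> simp [hl, hj]
  simp only [this]

theorem neighbourKey_injective (i : Fin n) : Function.Injective (neighbourKey x τ i) := by
  intro j l h
  have h2 : (if j = i then 0 else (τ i j : ℕ) + 1) = (if l = i then 0 else (τ i l : ℕ) + 1) :=
    congrArg (fun p => (ofLex p).2) h
  by_cases hl : l = i <;> by_cases hj : j = i <;> simp [hl, hj] at h2 ⊢
  have := (τ i).injective (Fin.ext h2)
  exact this

theorem card_nbrs {k : ℕ} (hk : k ≤ n) (i : Fin n) : (nbrs x τ k i).card = k := by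
  have := card_filter_card_lt_lt (neighbourKey_injective x τ i) (k := k) (by simpa using hk)
  rw [← this]
  unfold nbrs
  simp only [precedes_iff_neighbourKey_lt]
  congr!

open Classical in
theorem mem_nbrs {k : ℕ} {i j : Fin n} :
    j ∈ nbrs x τ k i ↔ (Finset.univ.filter fun l => Precedes x τ i l j).card < k := by
  simp [nbrs]

/-- Fewer than `k` indices come before a `k`-nearest neighbour. -/
theorem card_lt_of_precedes {k : ℕ} {i j : Fin n} (hj : j ∈ nbrs x τ k i) {s : Finset (Fin n)}
    (hs : ∀ l ∈ s, Precedes x τ i l j) : s.card < k := by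
  classical
  refine lt_of_le_of_lt (Finset.card_le_card fun l hl => ?_) ((mem_nbrs x τ).1 hj)
  simpa using hs l hl

theorem self_mem_nbrs {k : ℕ} (hk : 1 ≤ k) (i : Fin n) : i ∈ nbrs x τ k i := by
  classical
  rw [mem_nbrs, Finset.card_eq_zero.2 (Finset.filter_eq_empty_iff.2 _)]
  · omega
  · rintro l - (h | h)
    · rw [dist_self] at h
      exact absurd h (not_lt.2 dist_nonneg)
    · exact h.2.1 rfl

theorem dist_le_of_mem_nbrs {k : ℕ} {i j : Fin n} (hj : j ∈ nbrs x τ k i) {t : ℝ}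
    {s : Finset (Fin n)} (hs : ∀ l ∈ s, dist (x i) (x l) ≤ t) (hk : k ≤ s.card) :
    dist (x i) (x j) ≤ t := by
  by_contra! h
  exact absurd (card_lt_of_precedes x τ hj fun l hl => Or.inl ((hs l hl).trans_lt h)) (by omega)

/-- Two nonzero vectors whose directions are at distance less than one span an angle of less than
60 degrees, so that the shorter one is closer to the longer one than the origin is. -/
theorem norm_sub_lt_of_dist_direction_lt_one {E : Type*} [NormedAddCommGroup E]
    [InnerProductSpace ℝ E] {a b : E} (ha : a ≠ 0) (hb : b ≠ 0) (hab : ‖a‖ ≤ ‖b‖)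
    (h : dist (‖a‖⁻¹ • a) (‖b‖⁻¹ • b) < 1) : ‖b - a‖ < ‖b‖ := by
  have ha' : 0 < ‖a‖ := norm_pos_iff.2 ha
  have hb' : 0 < ‖b‖ := norm_pos_iff.2 hb
  have h1 : ‖‖a‖⁻¹ • a - ‖b‖⁻¹ • b‖ ^ 2 < 1 := by
    rw [dist_eq_norm] at h
    nlinarith [norm_nonneg (‖a‖⁻¹ • a - ‖b‖⁻¹ • b)]
  rw [norm_sub_sq_real, norm_smul, norm_smul, inner_smul_left, inner_smul_right, norm_inv, norm_inv,
    norm_norm, norm_norm, inv_mul_cancel₀ ha'.ne', inv_mul_cancel₀ hb'.ne'] at h1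
  simp only [conj_trivial] at h1
  have h2 : ‖a‖ * ‖b‖ < 2 * inner ℝ a b := by
    have h3 : 1 < 2 * (‖a‖⁻¹ * (‖b‖⁻¹ * inner ℝ a b)) := by linarith
    have h4 := mul_lt_mul_of_pos_left h3 (mul_pos ha' hb')
    have h5 : ‖a‖ * ‖b‖ * (2 * (‖a‖⁻¹ * (‖b‖⁻¹ * inner ℝ a b))) = 2 * inner ℝ a b := by
      field_simp
    linarith
  have h6 : ‖b - a‖ ^ 2 < ‖b‖ ^ 2 := by
    rw [norm_sub_sq_real, real_inner_comm]
    nlinarith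
  exact lt_of_pow_lt_pow_left₀ 2 hb'.le h6

/-- The number of balls of radius `1 / 2` needed to cover the unit sphere bounds, as a multiple of
`k`, how many points away from `x j` can have `j` among their `k` nearest neighbours. -/
theorem exists_card_reverse_nbrs_le (d : ℕ) : ∃ γ : ℕ, ∀ (n : ℕ)
    (x : Fin n → EuclideanSpace ℝ (Fin d)) (τ : Ties n) (k : ℕ) (j : Fin n)
    (s : Finset (Fin n)), (∀ i ∈ s, x i ≠ x j ∧ j ∈ nbrs x τ k i) → s.card ≤ k * γ := by
  classical
  obtain ⟨t, -, htf, ht⟩ := (isCompact_sphere (0 : EuclideanSpace ℝ (Fin d)) 1).finite_cover_balls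
    (e := 1 / 2) (by norm_num)
  refine ⟨htf.toFinset.card, fun n x τ k j s hs => ?_⟩
  -- assign to each point the ball that contains its direction as seen from `x j`
  have hcov : ∀ i, x i ≠ x j → ∃ c ∈ t, dist (‖x i - x j‖⁻¹ • (x i - x j)) c < 1 / 2 := by
    intro i hi
    have : ‖x i - x j‖⁻¹ • (x i - x j) ∈ Metric.sphere (0 : EuclideanSpace ℝ (Fin d)) 1 := by
      rw [mem_sphere_zero_iff_norm, norm_smul, norm_inv, norm_norm,
        inv_mul_cancel₀ (norm_ne_zero_iff.2 (sub_ne_zero.2 hi))]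
    simpa using ht this
  choose! c hct hc using hcov
  have := Finset.card_le_mul_card_image_of_maps_to (f := c) (s := s) (t := htf.toFinset)
    (fun i hi => htf.mem_toFinset.2 (hct i (hs i hi).1)) k ?_
  · exact this
  intro b _
  rcases Finset.eq_empty_or_nonempty (s.filter fun i => c i = b) with h0 | h0
  · simp [h0]
  -- the point of the class farthest from `x j` has all points of the class as closer neighbours
  obtain ⟨i, hi, hmax⟩ := Finset.exists_max_image _ (fun i => ‖x i - x j‖) h0
  rw [Finset.mem_filter] at hi
  refine (card_lt_of_precedes x τ (hs i hi.1).2 fun l hl => Or.inl ?_).le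
  have hle := hmax l hl
  rw [Finset.mem_filter] at hl
  have hi' := (hs i hi.1).1
  have hl' := (hs l hl.1).1
  have hd : dist (‖x l - x j‖⁻¹ • (x l - x j)) (‖x i - x j‖⁻¹ • (x i - x j)) < 1 := by
    have h1 := hc i hi'
    have h2 := hc l hl'
    rw [hi.2] at h1
    rw [hl.2] at h2
    have := dist_triangle_right (‖x l - x j‖⁻¹ • (x l - x j)) (‖x i - x j‖⁻¹ • (x i - x j)) b
    linarith
  have := norm_sub_lt_of_dist_direction_lt_one (sub_ne_zero.2 hl') (sub_ne_zero.2 hi') hle hd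
  rw [dist_eq_norm, dist_eq_norm]
  simpa using this

end

/-! ### Tie-breaking and coincident points -/

section

/-- The average of `∏ i, F i (τ i)` over all families of tie-breaking orders factorizes: under the
uniform law these orders are independent. -/
theorem average_prod_ties {n : ℕ} (F : Fin n → Equiv.Perm (Fin n) → ℝ) :
    (1 / (Fintype.card (Ties n) : ℝ)) * ∑ τ : Ties n, ∏ i, F i (τ i)
      = ∏ i, ((1 / (Fintype.card (Equiv.Perm (Fin n)) : ℝ)) * ∑ π, F i π) := by
  rw [Finset.prod_mul_distrib, Fintype.prod_sum, Finset.prod_const, Fintype.card_fun,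
    Finset.card_univ, Nat.cast_pow, one_div_pow]

variable {d n : ℕ} (x : Fin n → EuclideanSpace ℝ (Fin d)) (τ : Ties n)

/-- The number of indices whose `k` nearest neighbours include `j`. -/
def reverseCount (k : ℕ) (j : Fin n) : ℕ := (Finset.univ.filter fun i => j ∈ nbrs x τ k i).card

open Classical in
/-- The number of indices at the location of `x j` whose `k` nearest neighbours include `j`. -/
def coincidentCount (k : ℕ) (j : Fin n) : ℕ :=
  (Finset.univ.filter fun i => x i = x j ∧ j ∈ nbrs x τ k i).card

/-- Exchanging two coincident indices in the tie-breaking order exchanges them in the list of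
neighbours. -/
theorem precedes_swap {i l l' : Fin n} (hll : x l = x l') (hl : l ≠ i) (hl' : l' ≠ i)
    (π : Equiv.Perm (Fin n)) (a b : Fin n) :
    Precedes x (fun _ => (Equiv.swap l l').trans π) i a b ↔
      Precedes x (fun _ => π) i (Equiv.swap l l' a) (Equiv.swap l l' b) := by
  have h1 : ∀ a, x (Equiv.swap l l' a) = x a := by
    intro a
    by_cases ha : a = l
    · rw [ha, Equiv.swap_apply_left, hll]
    · by_cases ha' : a = l'
      · rw [ha', Equiv.swap_apply_right, hll]
      · rw [Equiv.swap_apply_of_ne_of_ne ha ha']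
  have h2 : ∀ a, Equiv.swap l l' a = i ↔ a = i := by
    intro a
    rw [Equiv.swap_apply_eq_iff, Equiv.swap_apply_of_ne_of_ne hl.symm hl'.symm]
  simp only [Precedes, h1, Equiv.trans_apply, ne_eq, h2]

theorem mem_nbrs_swap {i l l' : Fin n} (hll : x l = x l') (hl : l ≠ i) (hl' : l' ≠ i)
    (π : Equiv.Perm (Fin n)) (k : ℕ) :
    l ∈ nbrs x (fun _ => (Equiv.swap l l').trans π) k i ↔ l' ∈ nbrs x (fun _ => π) k i := by
  classical
  rw [mem_nbrs, mem_nbrs]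
  have : (Finset.univ.filter fun a => Precedes x (fun _ => (Equiv.swap l l').trans π) i a l).card
      = (Finset.univ.filter fun a => Precedes x (fun _ => π) i a l').card :=
    Finset.card_equiv (Equiv.swap l l') fun a => by
      simp only [Finset.mem_filter, Finset.mem_univ, true_and]
      rw [precedes_swap x hll hl hl', Equiv.swap_apply_left]
  rw [this]

/-- Two coincident points, both different from `x i` as indices, are equally likely to be among the
`k` nearest neighbours of the `i`-th point. -/
theorem card_perm_mem_nbrs_eq {i l l' : Fin n} (hll : x l = x l') (hl : l ≠ i) (hl' : l' ≠ i)
    (k : ℕ) :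
    (Finset.univ.filter fun π : Equiv.Perm (Fin n) => l' ∈ nbrs x (fun _ => π) k i).card
      = (Finset.univ.filter fun π : Equiv.Perm (Fin n) => l ∈ nbrs x (fun _ => π) k i).card :=
  Finset.card_equiv (Equiv.mulRight (Equiv.swap l l')) fun π => by
      simp only [Finset.mem_filter, Finset.mem_univ, true_and]
      exact (mem_nbrs_swap x hll hl hl' π k).symm

/-- Of the `m` indices at the location of `x i`, the `i`-th one is always among its own `k` nearest
neighbours; by symmetry, each of the `m - 1` others is with probability at most
`(k - 1) / (m - 1)`. -/
theorem card_perm_mem_nbrs_le {k : ℕ} (hk : 1 ≤ k) (hkn : k ≤ n) {i j : Fin n} (hne : i ≠ j)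
    {s : Finset (Fin n)} (hs : ∀ l ∈ s, x l = x j ∧ l ≠ i) :
    s.card * (Finset.univ.filter fun π : Equiv.Perm (Fin n) => j ∈ nbrs x (fun _ => π) k i).card
      ≤ (k - 1) * Fintype.card (Equiv.Perm (Fin n)) := by
  classical
  calc s.card * (Finset.univ.filter fun π : Equiv.Perm (Fin n) => j ∈ nbrs x (fun _ => π) k i).card
      = ∑ l ∈ s, (Finset.univ.filter fun π : Equiv.Perm (Fin n) =>
          l ∈ nbrs x (fun _ => π) k i).card := by
        rw [Finset.sum_congr rfl fun l hl => card_perm_mem_nbrs_eq x (hs l hl).1.symm hne.symm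
          (hs l hl).2 k, Finset.sum_const, smul_eq_mul]
    _ = ∑ π : Equiv.Perm (Fin n), (s.filter fun l => l ∈ nbrs x (fun _ => π) k i).card := by
        simp only [Finset.card_filter]
        exact Finset.sum_comm
    _ ≤ ∑ π : Equiv.Perm (Fin n), (k - 1) := by
        refine Finset.sum_le_sum fun π _ => ?_
        have hsub : (s.filter fun l => l ∈ nbrs x (fun _ => π) k i)
            ⊆ (nbrs x (fun _ => π) k i).erase i := by
          intro l hl
          rw [Finset.mem_filter] at hl
          exact Finset.mem_erase.2 ⟨(hs l hl.1).2, hl.2⟩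
        have := Finset.card_le_card hsub
        rwa [Finset.card_erase_of_mem (self_mem_nbrs x _ hk i), card_nbrs x _ hkn i] at this
    _ = (k - 1) * Fintype.card (Equiv.Perm (Fin n)) := by
        rw [Finset.sum_const, Finset.card_univ, smul_eq_mul, mul_comm]

theorem exp_inv_sub_one_le {k : ℕ} (hk : 1 ≤ k) : Real.exp (1 / k) - 1 ≤ 2 / k := by
  have hk' : (1 : ℝ) ≤ k := by exact_mod_cast hk
  have h1 : |(1 / k : ℝ)| ≤ 1 := by
    rw [abs_of_nonneg (by positivity), div_le_one (by linarith)]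
    exact hk'
  have h2 := (abs_le.1 (Real.abs_exp_sub_one_sub_id_le h1)).2
  have h3 : (1 / k : ℝ) ^ 2 ≤ 1 / k := by
    rw [abs_of_nonneg (by positivity)] at h1
    rw [sq]
    exact mul_le_of_le_one_left (by positivity) h1
  have h4 : (2 / k : ℝ) = 1 / k + 1 / k := by ring
  linarith

/-- The scaled number of coincident points that choose `j` has a bounded exponential moment, as a
sum of independent indicators whose probabilities add up to at most `k`. -/
theorem average_exp_coincidentCount_le {k : ℕ} (hk : 1 ≤ k) (hkn : k ≤ n) (j : Fin n) :
    (1 / (Fintype.card (Ties n) : ℝ)) *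
      ∑ τ : Ties n, Real.exp ((coincidentCount x τ k j : ℝ) / k) ≤ Real.exp 2 := by
  classical
  have hk0 : (0 : ℝ) < k := by exact_mod_cast hk
  set N : ℝ := ((Fintype.card (Equiv.Perm (Fin n)) : ℕ) : ℝ) with hN
  have hN0 : 0 < N := by rw [hN]; exact_mod_cast Fintype.card_pos
  set c : Fin n → ℝ := fun i => (Finset.univ.filter fun π : Equiv.Perm (Fin n) =>
    x i = x j ∧ j ∈ nbrs x (fun _ => π) k i).card with hc
  obtain ⟨F, hF⟩ : ∃ F : Fin n → Equiv.Perm (Fin n) → ℝ, ∀ i π, F i π =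
      if x i = x j ∧ j ∈ nbrs x (fun _ => π) k i then Real.exp (1 / k) else 1 :=
    ⟨_, fun _ _ => rfl⟩
  have h1 : ∀ τ : Ties n, Real.exp ((coincidentCount x τ k j : ℝ) / k) = ∏ i, F i (τ i) := by
    intro τ
    -- the neighbours of the `i`-th point depend on `τ i` only
    have h0 : ∀ i, F i (τ i) = if x i = x j ∧ j ∈ nbrs x τ k i then Real.exp (1 / k) else 1 :=
      fun i => (hF i (τ i)).trans (if_congr Iff.rfl rfl rfl)
    simp only [h0]
    rw [Finset.prod_ite, Finset.prod_const, Finset.prod_const_one, mul_one, ← Real.exp_nat_mul,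
      coincidentCount]
    congr 1
    rw [mul_one_div]
  simp only [h1]
  rw [average_prod_ties]
  simp only [hF]
  have h2 : ∀ i, (1 / N) * ∑ π : Equiv.Perm (Fin n),
      (if x i = x j ∧ j ∈ nbrs x (fun _ => π) k i then Real.exp (1 / k) else 1)
      ≤ Real.exp (c i / N * (2 / k)) := by
    intro i
    have h3 : ∑ π : Equiv.Perm (Fin n),
      (if x i = x j ∧ j ∈ nbrs x (fun _ => π) k i then Real.exp (1 / k) else 1)
        = N + c i * (Real.exp (1 / k) - 1) := by
      have : ∀ π : Equiv.Perm (Fin n),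
          (if x i = x j ∧ j ∈ nbrs x (fun _ => π) k i then Real.exp (1 / k) else 1)
          = 1 + (if x i = x j ∧ j ∈ nbrs x (fun _ => π) k i then (1 : ℝ) else 0)
            * (Real.exp (1 / k) - 1) := by
        intro π
        split_ifs <;> ring
      simp only [this, Finset.sum_add_distrib, ← Finset.sum_mul, Finset.sum_boole]
      simp [hN, hc]
    have h4 : 0 ≤ c i := by simp [hc]
    rw [h3]
    have h5 : 1 / N * (N + c i * (Real.exp (1 / k) - 1))
        = c i / N * (Real.exp (1 / k) - 1) + 1 := by
      field_simp
      ring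
    rw [h5]
    refine le_trans ?_ (Real.add_one_le_exp _)
    have := mul_le_mul_of_nonneg_left (exp_inv_sub_one_le hk) (div_nonneg h4 hN0.le)
    linarith
  refine (Finset.prod_le_prod (fun i _ => ?_) fun i _ => h2 i).trans ?_
  · exact mul_nonneg (by positivity) (Finset.sum_nonneg fun π _ => by split_ifs <;> positivity)
  rw [← Real.exp_sum]
  refine Real.exp_le_exp.2 ?_
  rw [← Finset.sum_mul, ← Finset.sum_div]
  suffices h : ∑ i, c i ≤ k * N by
    rw [div_mul_div_comm, div_le_iff₀ (by positivity)]
    linarith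
  set s : Finset (Fin n) := (Finset.univ.filter fun i => x i = x j).erase j with hs
  rw [← Finset.add_sum_erase _ _ (Finset.mem_univ j)]
  have hcj : c j ≤ N := by
    rw [hN]
    exact Nat.cast_le.2 (Finset.card_le_univ _)
  have hc0 : ∀ i ∈ Finset.univ.erase j, i ∉ s → c i = 0 := by
    intro i hi his
    have : ¬ x i = x j := by
      intro h
      exact his (Finset.mem_erase.2 ⟨Finset.ne_of_mem_erase hi, by simp [h]⟩)
    simp [hc, this]
  have hsum : ∑ i ∈ Finset.univ.erase j, c i = ∑ i ∈ s, c i :=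
    (Finset.sum_subset (Finset.erase_subset_erase _ (Finset.filter_subset _ _)) hc0).symm
  have hcs : ∀ i ∈ s, (s.card : ℝ) * c i ≤ (k - 1) * N := by
    intro i hi
    rw [hs, Finset.mem_erase, Finset.mem_filter] at hi
    -- exchange the roles of `i` and `j` to describe the other indices at this location
    have hcard : s.card = ((Finset.univ.filter fun l => x l = x j).erase i).card := by
      rw [hs, Finset.card_erase_of_mem (by simp), Finset.card_erase_of_mem (by simp [hi.2.2])]
    have := card_perm_mem_nbrs_le x hk hkn hi.1
      (s := (Finset.univ.filter fun l => x l = x j).erase i) (fun l hl => by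
        rw [Finset.mem_erase, Finset.mem_filter] at hl
        exact ⟨hl.2.2, hl.1⟩)
    rw [← hcard] at this
    have h6 : c i = (Finset.univ.filter fun π : Equiv.Perm (Fin n) =>
        j ∈ nbrs x (fun _ => π) k i).card := by
      simp [hc, hi.2.2]
    rw [h6, hN]
    have h7 : ((k - 1 : ℕ) : ℝ) = k - 1 := by rw [Nat.cast_sub hk, Nat.cast_one]
    rw [← h7]
    exact_mod_cast this
  have hle : ∑ i ∈ s, c i ≤ (k - 1) * N := by
    have hk1 : (0 : ℝ) ≤ k - 1 := by
      have : (1 : ℝ) ≤ k := by exact_mod_cast hk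
      linarith
    rcases s.eq_empty_or_nonempty with h0 | h0
    · rw [h0, Finset.sum_empty]
      positivity
    · have hpos : (0 : ℝ) < s.card := by exact_mod_cast h0.card_pos
      have := Finset.sum_le_sum hcs
      rw [← Finset.mul_sum, Finset.sum_const, nsmul_eq_mul] at this
      exact le_of_mul_le_mul_left this hpos
  rw [hsum]
  linarith

theorem sq_le_mul_exp_div {a b : ℝ} (ha : 0 ≤ a) (hb : 0 < b) :
    a ^ 2 ≤ 2 * b ^ 2 * Real.exp (a / b) := by
  have h := Real.quadratic_le_exp_of_nonneg (x := a / b) (by positivity)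
  have h1 : (a / b) ^ 2 / 2 ≤ Real.exp (a / b) := by
    have : 0 ≤ a / b := by positivity
    linarith
  calc a ^ 2 = 2 * b ^ 2 * ((a / b) ^ 2 / 2) := by field_simp
    _ ≤ _ := mul_le_mul_of_nonneg_left h1 (by positivity)

/-- The squared reverse neighbour counts add up to a multiple of `n k²`, on average over the
tie-breaking, and for every tie-breaking if the points are distinct. -/
theorem exists_sum_reverseCount_sq_le (d : ℕ) : ∃ Γ : ℝ, 0 ≤ Γ ∧ ∀ (n : ℕ)
    (x : Fin n → EuclideanSpace ℝ (Fin d)) (k : ℕ), 1 ≤ k → k ≤ n →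
    (1 / (Fintype.card (Ties n) : ℝ)) * ∑ τ : Ties n, ∑ j, (reverseCount x τ k j : ℝ) ^ 2
      ≤ Γ * n * k ^ 2 ∧
    (Function.Injective x → ∀ τ : Ties n, ∑ j, (reverseCount x τ k j : ℝ) ^ 2
      ≤ Γ * n * k ^ 2) := by
  classical
  obtain ⟨γ, hγ⟩ := exists_card_reverse_nbrs_le d
  refine ⟨2 * γ ^ 2 + 4 * Real.exp 2, by positivity, fun n x k hk hkn => ?_⟩
  have hk0 : (0 : ℝ) < k := by exact_mod_cast hk
  have hcount : ∀ (τ : Ties n) (j : Fin n), (reverseCount x τ k j : ℝ) ^ 2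
      ≤ 2 * (k * γ) ^ 2 + 2 * (coincidentCount x τ k j : ℝ) ^ 2 := by
    intro τ j
    have h1 : reverseCount x τ k j ≤ k * γ + coincidentCount x τ k j := by
      have h2 := hγ n x τ k j (Finset.univ.filter fun i => x i ≠ x j ∧ j ∈ nbrs x τ k i)
        fun i hi => by simpa using hi
      have h3 : (Finset.univ.filter fun i => j ∈ nbrs x τ k i)
          = (Finset.univ.filter fun i => x i ≠ x j ∧ j ∈ nbrs x τ k i)
            ∪ (Finset.univ.filter fun i => x i = x j ∧ j ∈ nbrs x τ k i) := by
        ext i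
        simp only [Finset.mem_union, Finset.mem_filter, Finset.mem_univ, true_and]
        tauto
      rw [reverseCount, h3]
      refine (Finset.card_union_le _ _).trans ?_
      rw [coincidentCount]
      exact Nat.add_le_add_right h2 _
    have h4 : (reverseCount x τ k j : ℝ) ≤ k * γ + coincidentCount x τ k j := by exact_mod_cast h1
    have h5 : (0 : ℝ) ≤ reverseCount x τ k j := by positivity
    nlinarith [sq_nonneg (k * γ - coincidentCount x τ k j : ℝ)]
  constructor
  · have h1 : ∀ j, (1 / (Fintype.card (Ties n) : ℝ)) * ∑ τ : Ties n, (reverseCount x τ k j : ℝ) ^ 2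
        ≤ (2 * γ ^ 2 + 4 * Real.exp 2) * k ^ 2 := by
      intro j
      have hcard : (0 : ℝ) < Fintype.card (Ties n) := by exact_mod_cast Fintype.card_pos
      have h2 : ∑ τ : Ties n, (reverseCount x τ k j : ℝ) ^ 2
          ≤ ∑ τ : Ties n, (2 * (k * γ) ^ 2
            + 4 * k ^ 2 * Real.exp ((coincidentCount x τ k j : ℝ) / k)) := by
        refine Finset.sum_le_sum fun τ _ => (hcount τ j).trans ?_
        have := sq_le_mul_exp_div (a := coincidentCount x τ k j) (by positivity) hk0
        linarith
      rw [Finset.sum_add_distrib, Finset.sum_const, ← Finset.mul_sum, Finset.card_univ,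
        nsmul_eq_mul] at h2
      have h3 := mul_le_mul_of_nonneg_left (average_exp_coincidentCount_le x hk hkn j)
        (by positivity : (0 : ℝ) ≤ 4 * k ^ 2)
      calc _ ≤ _ := mul_le_mul_of_nonneg_left h2 (by positivity)
        _ = 2 * (k * γ) ^ 2 + 4 * k ^ 2 * ((1 / (Fintype.card (Ties n) : ℝ)) *
          ∑ τ : Ties n, Real.exp ((coincidentCount x τ k j : ℝ) / k)) := by
            field_simp
        _ ≤ _ := by linarith
    rw [Finset.sum_comm, Finset.mul_sum]
    refine (Finset.sum_le_sum fun j _ => h1 j).trans_eq ?_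
    rw [Finset.sum_const, Finset.card_univ, Fintype.card_fin, nsmul_eq_mul]
    ring
  · intro hx τ
    have h1 : ∀ j, (reverseCount x τ k j : ℝ) ^ 2 ≤ (2 * γ ^ 2 + 4 * Real.exp 2) * k ^ 2 := by
      intro j
      have h2 : coincidentCount x τ k j ≤ 1 := by
        rw [coincidentCount]
        refine Finset.card_le_one.2 fun a ha b hb => hx ?_
        rw [(Finset.mem_filter.1 ha).2.1, (Finset.mem_filter.1 hb).2.1]
      have h3 : (coincidentCount x τ k j : ℝ) ^ 2 ≤ 1 := by
        have : (coincidentCount x τ k j : ℝ) ≤ 1 := by exact_mod_cast h2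
        exact pow_le_one₀ (by positivity) this
      have h4 : (1 : ℝ) ≤ k ^ 2 := one_le_pow₀ (by exact_mod_cast hk)
      have h5 : (1 : ℝ) ≤ Real.exp 2 := Real.one_le_exp (by norm_num)
      have h6 : (1 : ℝ) ≤ Real.exp 2 * k ^ 2 := by nlinarith
      nlinarith [hcount τ j]
    refine (Finset.sum_le_sum fun j _ => h1 j).trans_eq ?_
    rw [Finset.sum_const, Finset.card_univ, Fintype.card_fin, nsmul_eq_mul]
    ring

end

/-! ### Fourth moments of Gaussian noise -/

section

variable {v : ℝ≥0}

theorem integrable_pow_gaussianReal (r : ℕ) :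
    Integrable (fun t : ℝ => t ^ r) (gaussianReal 0 v) := by
  have := (memLp_id_gaussianReal (μ := 0) (v := v) r).integrable_norm_pow'
  refine this.mono (by fun_prop) (Filter.Eventually.of_forall fun t => ?_)
  simp

theorem integral_sq_gaussianReal : ∫ t, t ^ 2 ∂(gaussianReal 0 v) = v := by
  have h := variance_fun_id_gaussianReal (μ := 0) (v := v)
  rw [variance_eq_integral measurable_id'.aemeasurable] at h
  simpa using h

theorem integral_pow_four_gaussianReal : ∫ t, t ^ 4 ∂(gaussianReal 0 v) = 3 * (v : ℝ) ^ 2 := by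
  have h : iteratedDeriv 4 (mgf (fun x ↦ x) (gaussianReal 0 v)) 0
      = ∫ t, t ^ 4 ∂(gaussianReal 0 v) := by
    rw [iteratedDeriv_mgf_zero] <;> simp
  rw [← h, mgf_fun_id_gaussianReal]
  have key : ∀ (p p' : ℝ → ℝ), (∀ t, HasDerivAt p (p' t) t) →
      deriv (fun t => p t * Real.exp (0 * t + v * t ^ 2 / 2))
        = fun t => (p' t + v * t * p t) * Real.exp (0 * t + v * t ^ 2 / 2) := by
    intro p p' hp
    funext t
    have h1 : HasDerivAt (fun t : ℝ => 0 * t + v * t ^ 2 / 2) (v * t) t := by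
      have := ((hasDerivAt_id t).const_mul 0).add
        ((((hasDerivAt_id t).pow 2).const_mul (v : ℝ)).div_const 2)
      convert! this using 1
      simp; ring
    have h2 : HasDerivAt (fun t => p t * Real.exp (0 * t + v * t ^ 2 / 2)) _ t := (hp t).mul h1.exp
    rw [h2.deriv]
    ring
  have e0 : (fun t : ℝ => Real.exp (0 * t + v * t ^ 2 / 2))
      = fun t => (fun _ => (1 : ℝ)) t * Real.exp (0 * t + v * t ^ 2 / 2) := by simp
  rw [e0, iteratedDeriv_succ', iteratedDeriv_succ', iteratedDeriv_succ', iteratedDeriv_one,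
    key _ (fun _ => 0) (fun t => hasDerivAt_const t 1),
    key _ (fun _ => (v : ℝ)) (fun t => ?_), key _ (fun t => 2 * v ^ 2 * t) (fun t => ?_),
    key _ (fun t => 3 * v ^ 2 + 3 * v ^ 3 * t ^ 2) (fun t => ?_)]
  · simp
  · convert! ((hasDerivAt_pow 3 t).const_mul ((v : ℝ) ^ 3)).add
      ((hasDerivAt_id t).const_mul (3 * (v : ℝ) ^ 2)) using 1
    · ext t; simp; ring
    · simp; ring
  · convert! ((hasDerivAt_pow 2 t).const_mul ((v : ℝ) ^ 2)).const_add (v : ℝ) using 1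
    · ext t; ring
    · simp; ring
  · simpa using (((hasDerivAt_id t).const_mul (v : ℝ)))

variable {n : ℕ} {σ : ℝ}

/-- The variance of the noise as a nonnegative real. -/
def noiseVar (σ : ℝ) : ℝ≥0 := ⟨σ ^ 2, sq_nonneg σ⟩

theorem coe_noiseVar : (noiseVar σ : ℝ) = σ ^ 2 := rfl

theorem noise_eq_pi : noise n σ = Measure.pi fun _ => gaussianReal 0 (noiseVar σ) := rfl

instance (n : ℕ) (σ : ℝ) : IsProbabilityMeasure (noise n σ) := by
  rw [noise_eq_pi]; infer_instance

/-- The product of four coordinates, as a product over all coordinates of powers of each. -/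
theorem mul_mul_mul_eq_prod (ε : Fin n → ℝ) (i j k l : Fin n) :
    ε i * ε j * ε k * ε l = ∏ m, ε m ^ ((if i = m then 1 else 0) + (if j = m then 1 else 0)
      + (if k = m then 1 else 0) + (if l = m then 1 else 0)) := by
  simp only [pow_add, Finset.prod_mul_distrib, pow_ite, pow_one, pow_zero, Finset.prod_ite_eq,
    Finset.mem_univ, if_true]

theorem integrable_four (i j k l : Fin n) :
    Integrable (fun ε : Fin n → ℝ => ε i * ε j * ε k * ε l) (noise n σ) := by
  simp only [mul_mul_mul_eq_prod, noise_eq_pi]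
  exact Integrable.fintype_prod (f := fun m (t : ℝ) => t ^ ((if i = m then 1 else 0) +
    (if j = m then 1 else 0) + (if k = m then 1 else 0) + (if l = m then 1 else 0)))
    fun m => integrable_pow_gaussianReal _

theorem integral_four_eq_prod (i j k l : Fin n) :
    ∫ ε, ε i * ε j * ε k * ε l ∂(noise n σ) =
      ∏ m, ∫ t, t ^ ((if i = m then 1 else 0) + (if j = m then 1 else 0)
      + (if k = m then 1 else 0) + (if l = m then 1 else 0)) ∂(gaussianReal 0 (noiseVar σ)) := by
  simp only [mul_mul_mul_eq_prod, noise_eq_pi]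
  exact integral_fintype_prod_eq_prod (f := fun m (t : ℝ) => t ^ ((if i = m then 1 else 0) +
    (if j = m then 1 else 0) + (if k = m then 1 else 0) + (if l = m then 1 else 0)))

theorem integral_four_of_ne {i j k l : Fin n} (hj : j ≠ i) (hk : k ≠ i) (hl : l ≠ i) :
    ∫ ε, ε i * ε j * ε k * ε l ∂(noise n σ) = 0 := by
  rw [integral_four_eq_prod]
  refine Finset.prod_eq_zero (Finset.mem_univ i) ?_
  simp [hj, hk, hl]

theorem integral_four_pair {i k : Fin n} (h : i ≠ k) :
    ∫ ε, ε i * ε i * ε k * ε k ∂(noise n σ) = (σ ^ 2) ^ 2 := by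
  rw [integral_four_eq_prod, ← Finset.mul_prod_erase _ _ (Finset.mem_univ i),
    ← Finset.mul_prod_erase _ _ (Finset.mem_erase.2 ⟨h.symm, Finset.mem_univ k⟩),
    Finset.prod_eq_one fun m hm => ?_]
  · simp [h, h.symm, integral_sq_gaussianReal, coe_noiseVar]
    ring
  · simp only [Finset.mem_erase] at hm
    simp [hm.1.symm, hm.2.1.symm]

theorem integral_four_same (i : Fin n) :
    ∫ ε, ε i * ε i * ε i * ε i ∂(noise n σ) = 3 * (σ ^ 2) ^ 2 := by
  rw [integral_four_eq_prod, ← Finset.mul_prod_erase _ _ (Finset.mem_univ i),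
    Finset.prod_eq_one fun m hm => ?_]
  · simp [integral_pow_four_gaussianReal, coe_noiseVar]
  · simp only [Finset.mem_erase] at hm
    simp [hm.1.symm]

/-- Isserlis' formula for the fourth mixed moments of the noise. -/
theorem integral_four (i j k l : Fin n) :
    ∫ ε, ε i * ε j * ε k * ε l ∂(noise n σ) = (σ ^ 2) ^ 2 *
      ((if i = j then 1 else 0) * (if k = l then 1 else 0)
        + (if i = k then 1 else 0) * (if j = l then 1 else 0)
        + (if i = l then 1 else 0) * (if j = k then 1 else 0)) := by
  have c1 : ∀ a b c e : Fin n, ∫ ε, ε a * ε b * ε c * ε e ∂(noise n σ)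
      = ∫ ε, ε b * ε a * ε c * ε e ∂(noise n σ) := fun a b c e => by congr 1; ext ε; ring
  have c2 : ∀ a b c e : Fin n, ∫ ε, ε a * ε b * ε c * ε e ∂(noise n σ)
      = ∫ ε, ε a * ε c * ε b * ε e ∂(noise n σ) := fun a b c e => by congr 1; ext ε; ring
  have c3 : ∀ a b c e : Fin n, ∫ ε, ε a * ε b * ε c * ε e ∂(noise n σ)
      = ∫ ε, ε a * ε b * ε e * ε c ∂(noise n σ) := fun a b c e => by congr 1; ext ε; ring
  -- an index that occurs twice: the integral is zero unless the other two indices agree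
  have main : ∀ a c e : Fin n, ∫ ε, ε a * ε a * ε c * ε e ∂(noise n σ) = (σ ^ 2) ^ 2 *
      ((if c = e then 1 else 0) + (if a = c then 1 else 0) * (if a = e then 1 else 0)
        + (if a = e then 1 else 0) * (if a = c then 1 else 0)) := by
    intro a c e
    by_cases hce : c = e
    · subst hce
      by_cases hac : a = c
      · subst hac
        rw [integral_four_same]; simp; ring
      · rw [integral_four_pair hac]; simp [hac]
    · by_cases hac : a = c
      · subst hac
        rw [c3, c2, c1, integral_four_of_ne hce hce hce]
        simp [hce]
      · rw [c2, c1, integral_four_of_ne hac hac (Ne.symm hce)]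
        simp [hce, hac]
  by_cases hij : i = j
  · subst hij; rw [main]; simp
  by_cases hik : i = k
  · subst hik; rw [c2, main]; simp [hij, Ne.symm hij]
  by_cases hil : i = l
  · subst hil; rw [c3, c2, main]; simp [hij, hik, Ne.symm hij]
  rw [integral_four_of_ne (Ne.symm hij) (Ne.symm hik) (Ne.symm hil)]
  simp [hij, hik, hil]

end

/-! ### Quadratic forms and exponential moments of the noise -/

section

variable {n : ℕ} {σ : ℝ}

theorem mul_eq_prod (ε : Fin n → ℝ) (i j : Fin n) :
    ε i * ε j = ∏ m, ε m ^ ((if i = m then 1 else 0) + (if j = m then 1 else 0)) := by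
  simp only [pow_add, Finset.prod_mul_distrib, pow_ite, pow_one, pow_zero, Finset.prod_ite_eq,
    Finset.mem_univ, if_true]

theorem integrable_two (i j : Fin n) :
    Integrable (fun ε : Fin n → ℝ => ε i * ε j) (noise n σ) := by
  simp only [mul_eq_prod, noise_eq_pi]
  exact Integrable.fintype_prod (f := fun m (t : ℝ) => t ^ ((if i = m then 1 else 0) +
    (if j = m then 1 else 0))) fun m => integrable_pow_gaussianReal _

theorem integral_two (i j : Fin n) :
    ∫ ε, ε i * ε j ∂(noise n σ) = σ ^ 2 * (if i = j then 1 else 0) := by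
  simp only [mul_eq_prod, noise_eq_pi]
  rw [integral_fintype_prod_eq_prod (f := fun m (t : ℝ) => t ^ ((if i = m then 1 else 0) +
    (if j = m then 1 else 0)))]
  by_cases h : i = j
  · subst h
    rw [← Finset.mul_prod_erase _ _ (Finset.mem_univ i), Finset.prod_eq_one fun m hm => ?_]
    · simp [integral_sq_gaussianReal, coe_noiseVar]
    · simp only [Finset.mem_erase] at hm
      simp [hm.1.symm]
  · rw [if_neg h, mul_zero]
    refine Finset.prod_eq_zero (Finset.mem_univ i) ?_
    simp [Ne.symm h]

/-- The quadratic form with coefficients `M`, evaluated at the noise. -/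
def quadForm (M : Fin n → Fin n → ℝ) (ε : Fin n → ℝ) : ℝ := ∑ i, ∑ j, M i j * (ε i * ε j)

theorem integrable_quadForm (M : Fin n → Fin n → ℝ) :
    Integrable (quadForm M) (noise n σ) := by
  unfold quadForm
  exact integrable_finsetSum _ fun i _ => integrable_finsetSum _ fun j _ =>
    (integrable_two i j).const_mul _

theorem integral_quadForm (M : Fin n → Fin n → ℝ) :
    ∫ ε, quadForm M ε ∂(noise n σ) = σ ^ 2 * (∑ i, M i i) := by
  unfold quadForm
  rw [integral_finsetSum _ fun i _ => integrable_finsetSum _ fun j _ =>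
    (integrable_two i j).const_mul _]
  rw [Finset.mul_sum]
  refine Finset.sum_congr rfl fun i _ => ?_
  rw [integral_finsetSum _ fun j _ => (integrable_two i j).const_mul _]
  simp [integral_const_mul, integral_two, mul_comm]

theorem quadForm_sq (M : Fin n → Fin n → ℝ) (ε : Fin n → ℝ) :
    quadForm M ε ^ 2 = ∑ i, ∑ j, ∑ k, ∑ l, M i j * M k l * (ε i * ε j * ε k * ε l) := by
  unfold quadForm
  rw [sq, Finset.sum_mul]
  refine Finset.sum_congr rfl fun i _ => ?_
  rw [Finset.sum_mul]
  refine Finset.sum_congr rfl fun j _ => ?_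
  rw [Finset.mul_sum]
  refine Finset.sum_congr rfl fun k _ => ?_
  rw [Finset.mul_sum]
  refine Finset.sum_congr rfl fun l _ => ?_
  ring

theorem integrable_quadForm_sq (M : Fin n → Fin n → ℝ) :
    Integrable (fun ε => quadForm M ε ^ 2) (noise n σ) := by
  simp only [quadForm_sq]
  exact integrable_finsetSum _ fun i _ => integrable_finsetSum _ fun j _ =>
    integrable_finsetSum _ fun k _ => integrable_finsetSum _ fun l _ =>
    (integrable_four i j k l).const_mul _

theorem integral_quadForm_sq (M : Fin n → Fin n → ℝ) :
    ∫ ε, quadForm M ε ^ 2 ∂(noise n σ) = (σ ^ 2) ^ 2 *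
      ((∑ i, M i i) ^ 2 + ∑ i, ∑ j, M i j ^ 2 + ∑ i, ∑ j, M i j * M j i) := by
  have i4 := fun i j k l : Fin n => integrable_four (σ := σ) i j k l
  simp only [quadForm_sq]
  rw [integral_finsetSum _ fun i _ => integrable_finsetSum _ fun j _ =>
    integrable_finsetSum _ fun k _ => integrable_finsetSum _ fun l _ => (i4 i j k l).const_mul _]
  have e1 : ∀ i, ∫ ε, ∑ j, ∑ k, ∑ l, M i j * M k l * (ε i * ε j * ε k * ε l) ∂(noise n σ)
      = ∑ j, ∑ k, ∑ l, M i j * M k l * ∫ ε, (ε i * ε j * ε k * ε l) ∂(noise n σ) := by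
    intro i
    rw [integral_finsetSum _ fun j _ => integrable_finsetSum _ fun k _ =>
      integrable_finsetSum _ fun l _ => (i4 i j k l).const_mul _]
    refine Finset.sum_congr rfl fun j _ => ?_
    rw [integral_finsetSum _ fun k _ => integrable_finsetSum _ fun l _ =>
      (i4 i j k l).const_mul _]
    refine Finset.sum_congr rfl fun k _ => ?_
    rw [integral_finsetSum _ fun l _ => (i4 i j k l).const_mul _]
    simp only [integral_const_mul]
  simp only [e1, integral_four, mul_add, Finset.sum_add_distrib]
  congr 1
  · congr 1
    · rw [sq (∑ i, M i i), Finset.sum_mul_sum]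
      simp [Finset.mul_sum]
      refine Finset.sum_congr rfl fun i _ => Finset.sum_congr rfl fun j _ => ?_
      ring
    · simp [Finset.mul_sum]
      refine Finset.sum_congr rfl fun i _ => Finset.sum_congr rfl fun j _ => ?_
      ring
  · simp [Finset.mul_sum]
    refine Finset.sum_congr rfl fun i _ => Finset.sum_congr rfl fun j _ => ?_
    ring

theorem integrable_quadForm_sub_sq (M : Fin n → Fin n → ℝ) (c : ℝ) :
    Integrable (fun ε => (quadForm M ε - c) ^ 2) (noise n σ) := by
  have : (fun ε => (quadForm M ε - c) ^ 2)
      = fun ε => quadForm M ε ^ 2 - 2 * c * quadForm M ε + c ^ 2 := by ext ε; ring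
  rw [this]
  exact ((integrable_quadForm_sq M).sub ((integrable_quadForm M).const_mul _)).add
    (integrable_const _)

/-- The variance of a quadratic form of the noise is at most twice the squared Frobenius norm. -/
theorem integral_quadForm_sub_sq_le (M : Fin n → Fin n → ℝ) :
    ∫ ε, (quadForm M ε - σ ^ 2 * (∑ i, M i i)) ^ 2 ∂(noise n σ)
      ≤ 2 * (σ ^ 2) ^ 2 * ∑ i, ∑ j, M i j ^ 2 := by
  have : (fun ε => (quadForm M ε - σ ^ 2 * (∑ i, M i i)) ^ 2)
      = fun ε => quadForm M ε ^ 2 - 2 * (σ ^ 2 * (∑ i, M i i)) * quadForm M ε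
        + (σ ^ 2 * (∑ i, M i i)) ^ 2 := by ext ε; ring
  have hint : Integrable (fun ε => quadForm M ε ^ 2 - 2 * (σ ^ 2 * (∑ i, M i i)) * quadForm M ε)
      (noise n σ) := (integrable_quadForm_sq M).sub ((integrable_quadForm M).const_mul _)
  rw [this, integral_add hint (integrable_const _), integral_sub (integrable_quadForm_sq M)
    ((integrable_quadForm M).const_mul _), integral_const_mul, integral_quadForm,
    integral_quadForm_sq]
  simp only [integral_const, probReal_univ, one_smul]
  have h1 : ∑ i, ∑ j, M i j * M j i ≤ ∑ i, ∑ j, M i j ^ 2 := by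
    have h2 : ∑ i, ∑ j, M j i ^ 2 = ∑ i, ∑ j, M i j ^ 2 := Finset.sum_comm
    have h3 : ∑ i, ∑ j, M i j * M j i ≤ ∑ i, ∑ j, (M i j ^ 2 + M j i ^ 2) / 2 :=
      Finset.sum_le_sum fun i _ => Finset.sum_le_sum fun j _ => by
        nlinarith [sq_nonneg (M i j - M j i)]
    simp only [← Finset.sum_div, Finset.sum_add_distrib, h2] at h3
    linarith
  nlinarith [mul_le_mul_of_nonneg_left h1 (sq_nonneg (σ ^ 2))]

theorem sq_sum_mul_eq_quadForm (a ε : Fin n → ℝ) :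
    (∑ i, a i * ε i) ^ 2 = quadForm (fun i j => a i * a j) ε := by
  simp only [quadForm, sq, Finset.sum_mul_sum]
  refine Finset.sum_congr rfl fun i _ => Finset.sum_congr rfl fun j _ => ?_
  ring

theorem integrable_sq_sum_mul (a : Fin n → ℝ) :
    Integrable (fun ε : Fin n → ℝ => (∑ i, a i * ε i) ^ 2) (noise n σ) := by
  simp only [sq_sum_mul_eq_quadForm]
  exact integrable_quadForm _

theorem integral_sq_sum_mul (a : Fin n → ℝ) :
    ∫ ε, (∑ i, a i * ε i) ^ 2 ∂(noise n σ) = σ ^ 2 * ∑ i, a i ^ 2 := by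
  simp only [sq_sum_mul_eq_quadForm, integral_quadForm]
  simp [sq]

theorem integrable_exp_sum_mul (a : Fin n → ℝ) :
    Integrable (fun ε : Fin n → ℝ => Real.exp (∑ i, a i * ε i)) (noise n σ) := by
  simp only [Real.exp_sum, noise_eq_pi]
  exact Integrable.fintype_prod (f := fun i (t : ℝ) => Real.exp (a i * t))
    fun i => integrable_exp_mul_gaussianReal _

theorem integral_exp_sum_mul (a : Fin n → ℝ) :
    ∫ ε, Real.exp (∑ i, a i * ε i) ∂(noise n σ) = Real.exp (σ ^ 2 * (∑ i, a i ^ 2) / 2) := by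
  simp only [Real.exp_sum, noise_eq_pi]
  rw [integral_fintype_prod_eq_prod (f := fun i (t : ℝ) => Real.exp (a i * t))]
  have : ∀ i, ∫ t, Real.exp (a i * t) ∂(gaussianReal 0 (noiseVar σ))
      = Real.exp (σ ^ 2 * a i ^ 2 / 2) := by
    intro i
    have := congrFun (mgf_fun_id_gaussianReal (μ := 0) (v := noiseVar σ)) (a i)
    rw [mgf] at this
    rw [this, coe_noiseVar, zero_mul, zero_add]
  simp only [this, ← Real.exp_sum, Finset.mul_sum, Finset.sum_div]

theorem integral_exp_mul_sq_gaussianReal (hσ : 0 < σ) {θ : ℝ} (hθ : θ < 1 / 2) :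
    ∫ t, Real.exp (θ / σ ^ 2 * t ^ 2) ∂(gaussianReal 0 (noiseVar σ)) = (√(1 - 2 * θ))⁻¹ := by
  have hv : noiseVar σ ≠ 0 := by
    intro h
    have := congrArg NNReal.toReal h
    rw [coe_noiseVar] at this
    exact (pow_pos hσ 2).ne' this
  rw [integral_gaussianReal_eq_integral_smul hv]
  have h1 : ∀ t : ℝ, gaussianPDFReal 0 (noiseVar σ) t • Real.exp (θ / σ ^ 2 * t ^ 2)
      = (√(2 * Real.pi * σ ^ 2))⁻¹ * Real.exp (-((1 - 2 * θ) / (2 * σ ^ 2)) * t ^ 2) := by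
    intro t
    rw [gaussianPDFReal_def, coe_noiseVar, smul_eq_mul, mul_assoc, ← Real.exp_add]
    congr 2
    field_simp
    ring
  simp only [h1]
  rw [integral_const_mul, integral_gaussian, ← Real.sqrt_inv, ← Real.sqrt_inv, ← Real.sqrt_mul]
  · congr 1
    have := Real.pi_pos
    have : 1 - 2 * θ ≠ 0 := by linarith
    field_simp
  · positivity

theorem integrable_exp_mul_sq_gaussianReal (hσ : 0 < σ) {θ : ℝ} (hθ : θ < 1 / 2) :
    Integrable (fun t => Real.exp (θ / σ ^ 2 * t ^ 2)) (gaussianReal 0 (noiseVar σ)) := by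
  refine not_imp_comm.1 integral_undef ?_
  rw [integral_exp_mul_sq_gaussianReal hσ hθ]
  have : 0 < √(1 - 2 * θ) := Real.sqrt_pos.2 (by linarith)
  positivity

theorem integrable_exp_mul_sum_sq (hσ : 0 < σ) {θ : ℝ} (hθ : θ < 1 / 2) :
    Integrable (fun ε : Fin n → ℝ => Real.exp (θ / σ ^ 2 * ∑ i, ε i ^ 2)) (noise n σ) := by
  simp only [Finset.mul_sum, Real.exp_sum, noise_eq_pi]
  exact Integrable.fintype_prod (f := fun i (t : ℝ) => Real.exp (θ / σ ^ 2 * t ^ 2))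
    fun i => integrable_exp_mul_sq_gaussianReal hσ hθ

theorem inv_sqrt_one_sub_le_exp {θ : ℝ} (h0 : 0 ≤ θ) (hθ : θ ≤ 1 / 6) :
    (√(1 - 2 * θ))⁻¹ ≤ Real.exp (θ + 2 * θ ^ 2) := by
  have h1 : 1 ≤ (1 - 2 * θ) * Real.exp (2 * (θ + 2 * θ ^ 2)) := by
    have h2 := Real.quadratic_le_exp_of_nonneg (x := 2 * (θ + 2 * θ ^ 2)) (by positivity)
    have h3 : 1 + 2 * θ + 6 * θ ^ 2 ≤ Real.exp (2 * (θ + 2 * θ ^ 2)) := by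
      refine le_trans ?_ h2
      nlinarith [pow_nonneg h0 3, pow_nonneg h0 4]
    have h4 : (1 - 2 * θ) * (1 + 2 * θ + 6 * θ ^ 2)
        ≤ (1 - 2 * θ) * Real.exp (2 * (θ + 2 * θ ^ 2)) :=
      mul_le_mul_of_nonneg_left h3 (by linarith)
    refine le_trans ?_ h4
    nlinarith [mul_nonneg (sq_nonneg θ) (by linarith : 0 ≤ 1 - 6 * θ)]
  have hs : 0 < √(1 - 2 * θ) := Real.sqrt_pos.2 (by linarith)
  rw [inv_le_iff_one_le_mul₀ hs, ← one_le_sq_iff₀ (by positivity), mul_pow,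
    Real.sq_sqrt (by linarith), ← Real.exp_nat_mul, mul_comm]
  exact_mod_cast h1

/-- The Laplace transform of the squared norm of the noise. -/
theorem integral_exp_mul_sum_sq_le (hσ : 0 < σ) {θ : ℝ} (h0 : 0 ≤ θ) (hθ : θ ≤ 1 / 6) :
    ∫ ε, Real.exp (θ / σ ^ 2 * ∑ i, ε i ^ 2) ∂(noise n σ)
      ≤ Real.exp (n * (θ + 2 * θ ^ 2)) := by
  simp only [Finset.mul_sum, Real.exp_sum, noise_eq_pi]
  rw [integral_fintype_prod_eq_pow (ι := Fin n) (fun t : ℝ => Real.exp (θ / σ ^ 2 * t ^ 2)),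
    integral_exp_mul_sq_gaussianReal hσ (by linarith), Fintype.card_fin, Real.exp_nat_mul]
  exact pow_le_pow_left₀ (by positivity) (inv_sqrt_one_sub_le_exp h0 hθ) n

end

/-! ### The bias for a fixed design -/

section

variable {d n : ℕ}

theorem dist_sq_le_of_abs_sub_le {p q : EuclideanSpace ℝ (Fin d)} {r : ℝ}
    (h : ∀ a, |p a - q a| ≤ r) : dist p q ^ 2 ≤ d * r ^ 2 := by
  rw [EuclideanSpace.dist_eq, Real.sq_sqrt (Finset.sum_nonneg fun _ _ => sq_nonneg _)]
  refine (Finset.sum_le_sum fun a _ => (?_ : _ ≤ r ^ 2)).trans_eq (by simp)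
  rw [Real.dist_eq]
  exact pow_le_pow_left₀ (abs_nonneg _) (h a) 2

theorem dist_sq_le_of_mem_cube {p q : EuclideanSpace ℝ (Fin d)} (hp : p ∈ cube d)
    (hq : q ∈ cube d) : dist p q ^ 2 ≤ d := by
  have := dist_sq_le_of_abs_sub_le (p := p) (q := q) (r := 1) fun a => by
    rw [abs_le]
    constructor <;> linarith [(hp a).1, (hp a).2, (hq a).1, (hq a).2]
  simpa using this

/-- The label of the dyadic cell of side `2⁻ᵐ` that contains `p`. -/
def dyadicCell (m : ℕ) (p : EuclideanSpace ℝ (Fin d)) : Fin d → ℤ := fun a => ⌊(2 : ℝ) ^ m * p a⌋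

theorem dist_sq_le_of_dyadicCell_eq {m : ℕ} {p q : EuclideanSpace ℝ (Fin d)}
    (h : dyadicCell m p = dyadicCell m q) : dist p q ^ 2 ≤ d * (1 / 4) ^ m := by
  have h1 : ∀ a, |p a - q a| ≤ (1 / 2) ^ m := by
    intro a
    have h2 := Int.abs_sub_lt_one_of_floor_eq_floor (congrFun h a)
    rw [← mul_sub, abs_mul, abs_of_pos (by positivity)] at h2
    rw [one_div, inv_pow, ← one_div, le_div_iff₀ (by positivity)]
    linarith
  have := dist_sq_le_of_abs_sub_le h1
  rwa [← pow_mul, mul_comm m 2, pow_mul, show ((1 : ℝ) / 2) ^ 2 = 1 / 4 by norm_num] at this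

theorem dyadicCell_mem {m : ℕ} {p : EuclideanSpace ℝ (Fin d)} (hp : p ∈ cube d) :
    dyadicCell m p ∈ Fintype.piFinset fun _ : Fin d => Finset.Icc (0 : ℤ) (2 ^ m) := by
  rw [Fintype.mem_piFinset]
  intro a
  rw [Finset.mem_Icc, dyadicCell]
  constructor
  · exact Int.floor_nonneg.2 (mul_nonneg (by positivity) (hp a).1)
  · have h1 : (2 : ℝ) ^ m * p a ≤ 2 ^ m := mul_le_of_le_one_right (by positivity) (hp a).2
    have h2 := Int.floor_le_floor h1
    refine h2.trans_eq ?_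
    have : (2 : ℝ) ^ m = ((2 ^ m : ℤ) : ℝ) := by push_cast; rfl
    rw [this, Int.floor_intCast]

variable (x : Fin n → EuclideanSpace ℝ (Fin d))

/-- The indices whose dyadic cell of side `2⁻ᵐ` contains fewer than `k` design points. -/
def sparseIndices (k m : ℕ) : Finset (Fin n) :=
  Finset.univ.filter fun i =>
    (Finset.univ.filter fun l => dyadicCell m (x l) = dyadicCell m (x i)).card < k

theorem card_sparseIndices_le (hx : ∀ i, x i ∈ cube d) (k m : ℕ) :
    (sparseIndices x k m).card ≤ k * (2 ^ m + 1) ^ d := by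
  classical
  have h := Finset.card_le_mul_card_image_of_maps_to (f := fun i => dyadicCell m (x i))
    (s := sparseIndices x k m) (t := Fintype.piFinset fun _ : Fin d => Finset.Icc (0 : ℤ) (2 ^ m))
    (fun i _ => dyadicCell_mem (hx i)) k ?_
  · refine h.trans_eq ?_
    rw [Fintype.card_piFinset]
    simp only [Int.card_Icc, Finset.prod_const, Finset.card_univ, Fintype.card_fin]
    congr 2
  · intro b _
    rcases Finset.eq_empty_or_nonempty
      ((sparseIndices x k m).filter fun i => dyadicCell m (x i) = b) with h0 | ⟨i, hi⟩
    · simp [h0]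
    · rw [Finset.mem_filter, sparseIndices, Finset.mem_filter] at hi
      refine (Finset.card_le_card fun l hl => ?_).trans hi.1.2.le
      rw [Finset.mem_filter] at hl ⊢
      exact ⟨Finset.mem_univ _, hl.2.trans hi.2.symm⟩

variable (τ : Ties n)

/-- A `k`-nearest neighbour is at most a cell diameter away, for the smallest dyadic cell around
`x i` that holds `k` design points. -/
theorem dist_sq_le_dyadic (hx : ∀ i, x i ∈ cube d) {k : ℕ} {i j : Fin n}
    (hj : j ∈ nbrs x τ k i) (M : ℕ) :
    dist (x i) (x j) ^ 2 ≤ d * ((1 / 4) ^ M + ∑ m ∈ Finset.range M,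
      (1 / 4) ^ m * if i ∈ sparseIndices x k (m + 1) then (1 : ℝ) else 0) := by
  induction M with
  | zero => simpa using dist_sq_le_of_mem_cube (hx i) (hx j)
  | succ M ih =>
    rw [Finset.sum_range_succ]
    by_cases h : i ∈ sparseIndices x k (M + 1)
    · rw [if_pos h]
      refine ih.trans (mul_le_mul_of_nonneg_left ?_ (by positivity))
      have : (0 : ℝ) ≤ (1 / 4) ^ (M + 1) := by positivity
      linarith
    · rw [if_neg h]
      have h1 : k ≤ (Finset.univ.filter fun l =>
          dyadicCell (M + 1) (x l) = dyadicCell (M + 1) (x i)).card := by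
        simpa [sparseIndices] using h
      have h2 : dist (x i) (x j) ≤ √(d * (1 / 4) ^ (M + 1)) := by
        refine dist_le_of_mem_nbrs x τ hj (fun l hl => ?_) h1
        refine Real.le_sqrt_of_sq_le (dist_sq_le_of_dyadicCell_eq ?_)
        exact (Finset.mem_filter.1 hl).2.symm
      have h3 := pow_le_pow_left₀ dist_nonneg h2 2
      rw [Real.sq_sqrt (by positivity)] at h3
      refine h3.trans (mul_le_mul_of_nonneg_left ?_ (by positivity))
      have : (0 : ℝ) ≤ ∑ m ∈ Finset.range M,
          (1 / 4) ^ m * if i ∈ sparseIndices x k (m + 1) then (1 : ℝ) else 0 :=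
        Finset.sum_nonneg fun m _ => by split_ifs <;> positivity
      linarith

theorem smoother_mulVec (k : ℕ) (y : Fin n → ℝ) (i : Fin n) :
    (smoother x τ k *ᵥ y) i = (1 / k) * ∑ j ∈ nbrs x τ k i, y j := by
  simp [smoother, Matrix.mulVec, dotProduct, Finset.mul_sum, ite_mul, Finset.sum_ite_mem]

/-- The error of the `k`-nearest-neighbour estimator at the design points without noise. -/
def biasVec (f : EuclideanSpace ℝ (Fin d) → ℝ) (k : ℕ) (i : Fin n) : ℝ :=
  (smoother x τ k *ᵥ fun j => f (x j)) i - f (x i)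

theorem abs_biasVec_le {f : EuclideanSpace ℝ (Fin d) → ℝ} {L : ℝ≥0}
    (hf : LipschitzOnWith L f (cube d)) (hx : ∀ i, x i ∈ cube d) {k : ℕ} (hk : 1 ≤ k) (hkn : k ≤ n)
    {i : Fin n} {t : ℝ} (ht : ∀ j ∈ nbrs x τ k i, dist (x i) (x j) ≤ t) :
    |biasVec x τ f k i| ≤ L * t := by
  have hk0 : (0 : ℝ) < k := by exact_mod_cast hk
  have h1 : biasVec x τ f k i = (1 / k) * ∑ j ∈ nbrs x τ k i, (f (x j) - f (x i)) := by
    rw [biasVec, smoother_mulVec, Finset.sum_sub_distrib, Finset.sum_const, card_nbrs x τ hkn,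
      nsmul_eq_mul]
    field_simp
  rw [h1, abs_mul, abs_of_pos (by positivity)]
  have h2 : |∑ j ∈ nbrs x τ k i, (f (x j) - f (x i))| ≤ k * (L * t) := by
    refine (Finset.abs_sum_le_sum_abs _ _).trans ?_
    refine (Finset.sum_le_sum fun j hj => (?_ : _ ≤ L * t)).trans_eq ?_
    · have := hf.dist_le_mul _ (hx i) _ (hx j)
      rw [Real.dist_eq, abs_sub_comm] at this
      exact this.trans (mul_le_mul_of_nonneg_left (ht j hj) L.2)
    · rw [Finset.sum_const, card_nbrs x τ hkn, nsmul_eq_mul]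
  calc _ ≤ 1 / (k : ℝ) * (k * (L * t)) := mul_le_mul_of_nonneg_left h2 (by positivity)
    _ = L * t := by field_simp

theorem sq_biasVec_le {f : EuclideanSpace ℝ (Fin d) → ℝ} {L : ℝ≥0}
    (hf : LipschitzOnWith L f (cube d)) (hx : ∀ i, x i ∈ cube d) {k : ℕ} (hk : 1 ≤ k) (hkn : k ≤ n)
    {i : Fin n} {t : ℝ} (ht : ∀ j ∈ nbrs x τ k i, dist (x i) (x j) ^ 2 ≤ t) :
    biasVec x τ f k i ^ 2 ≤ L ^ 2 * t := by
  have ht0 : 0 ≤ t := (sq_nonneg _).trans (ht i (self_mem_nbrs x τ hk i))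
  have h := abs_biasVec_le x τ hf hx hk hkn (i := i) (t := √t)
    fun j hj => Real.le_sqrt_of_sq_le (ht j hj)
  have h2 := pow_le_pow_left₀ (abs_nonneg _) h 2
  rwa [sq_abs, mul_pow, Real.sq_sqrt ht0] at h2

theorem sum_sq_biasVec_le_dim {f : EuclideanSpace ℝ (Fin d) → ℝ} {L : ℝ≥0}
    (hf : LipschitzOnWith L f (cube d)) (hx : ∀ i, x i ∈ cube d) {k : ℕ} (hk : 1 ≤ k)
    (hkn : k ≤ n) : ∑ i, biasVec x τ f k i ^ 2 ≤ n * (L ^ 2 * d) := by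
  refine (Finset.sum_le_sum fun i _ => sq_biasVec_le x τ hf hx hk hkn (t := d)
    fun j _ => dist_sq_le_of_mem_cube (hx i) (hx j)).trans_eq ?_
  simp

/-- The squared bias. In dimension at least three, the sum over the dyadic scales up to `2⁻ᴹ` is
dominated by its last term. -/
theorem sum_sq_biasVec_le (hd : 2 < d) {f : EuclideanSpace ℝ (Fin d) → ℝ} {L : ℝ≥0}
    (hf : LipschitzOnWith L f (cube d)) (hx : ∀ i, x i ∈ cube d) {k : ℕ} (hk : 1 ≤ k)
    (hkn : k ≤ n) (M : ℕ) :
    ∑ i, biasVec x τ f k i ^ 2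
      ≤ L ^ 2 * (d * (n * (1 / 4) ^ M + k * (4 ^ d * (2 ^ d / 4) ^ M))) := by
  have h1 : ∀ i, biasVec x τ f k i ^ 2 ≤ L ^ 2 * (d * ((1 / 4) ^ M + ∑ m ∈ Finset.range M,
      (1 / 4) ^ m * if i ∈ sparseIndices x k (m + 1) then (1 : ℝ) else 0)) := fun i =>
    sq_biasVec_le x τ hf hx hk hkn fun j hj => dist_sq_le_dyadic x τ hx hj M
  refine (Finset.sum_le_sum fun i _ => h1 i).trans ?_
  rw [← Finset.mul_sum, ← Finset.mul_sum, Finset.sum_add_distrib, Finset.sum_const,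
    Finset.card_univ, Fintype.card_fin, nsmul_eq_mul, Finset.sum_comm]
  refine mul_le_mul_of_nonneg_left (mul_le_mul_of_nonneg_left (add_le_add_right ?_ _)
    (by positivity)) (by positivity)
  have hq : (2 : ℝ) ≤ 2 ^ d / 4 := by
    have : (2 : ℝ) ^ 3 ≤ 2 ^ d := pow_le_pow_right₀ (by norm_num) hd
    linarith
  have h2 : ∀ m, ∑ i, (1 / 4 : ℝ) ^ m * (if i ∈ sparseIndices x k (m + 1) then (1 : ℝ) else 0)
      ≤ k * (4 ^ d * (2 ^ d / 4) ^ m) := by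
    intro m
    rw [← Finset.mul_sum, Finset.sum_boole, Finset.filter_mem_eq_inter, Finset.univ_inter]
    have h3 : ((sparseIndices x k (m + 1)).card : ℝ) ≤ k * (2 ^ (m + 1) + 1) ^ d := by
      exact_mod_cast card_sparseIndices_le x hx k (m + 1)
    have h4 : ((2 : ℝ) ^ (m + 1) + 1) ^ d ≤ (4 * 2 ^ m) ^ d := by
      refine pow_le_pow_left₀ (by positivity) ?_ d
      have : (1 : ℝ) ≤ 2 ^ m := one_le_pow₀ (by norm_num)
      rw [pow_succ]
      linarith
    calc _ ≤ (1 / 4 : ℝ) ^ m * (k * (4 * 2 ^ m) ^ d) :=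
          mul_le_mul_of_nonneg_left (h3.trans (mul_le_mul_of_nonneg_left h4 (by positivity)))
            (by positivity)
      _ = _ := by
          rw [mul_pow, div_pow, div_pow, ← pow_mul, ← pow_mul, mul_comm m d, one_pow]
          ring
  have h5 : ∀ M, ∑ m ∈ Finset.range M, ((2 : ℝ) ^ d / 4) ^ m ≤ (2 ^ d / 4) ^ M := by
    intro M
    induction M with
    | zero => simp
    | succ M ih =>
      rw [Finset.sum_range_succ, pow_succ]
      nlinarith [pow_pos (by linarith : (0 : ℝ) < 2 ^ d / 4) M]
  refine (Finset.sum_le_sum fun m _ => h2 m).trans ?_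
  rw [← Finset.mul_sum, ← Finset.mul_sum]
  exact mul_le_mul_of_nonneg_left (mul_le_mul_of_nonneg_left (h5 M) (by positivity))
    (by positivity)

end

/-! ### The risk, the loss and the stopping rule -/

section

variable {d n : ℕ} (x : Fin n → EuclideanSpace ℝ (Fin d)) (τ : Ties n)
  (f : EuclideanSpace ℝ (Fin d) → ℝ)

theorem smoother_apply (k : ℕ) (i j : Fin n) :
    smoother x τ k i j = if j ∈ nbrs x τ k i then 1 / (k : ℝ) else 0 := rfl

theorem smoother_nonneg (k : ℕ) (i j : Fin n) : 0 ≤ smoother x τ k i j := by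
  rw [smoother_apply]
  split_ifs <;> positivity

theorem smoother_le (k : ℕ) (i j : Fin n) : smoother x τ k i j ≤ 1 / k := by
  rw [smoother_apply]
  split_ifs
  · exact le_rfl
  · positivity

theorem sum_smoother {k : ℕ} (hk : 1 ≤ k) (hkn : k ≤ n) (i : Fin n) :
    ∑ j, smoother x τ k i j = 1 := by
  have hk0 : (k : ℝ) ≠ 0 := by positivity
  simp only [smoother_apply]
  rw [Finset.sum_ite_mem, Finset.univ_inter, Finset.sum_const, card_nbrs x τ hkn, nsmul_eq_mul]
  field_simp

theorem sum_smoother_sq {k : ℕ} (hk : 1 ≤ k) (hkn : k ≤ n) (i : Fin n) :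
    ∑ j, smoother x τ k i j ^ 2 = 1 / k := by
  have hk0 : (k : ℝ) ≠ 0 := by positivity
  simp only [smoother_apply, ite_pow]
  rw [zero_pow two_ne_zero, Finset.sum_ite_mem, Finset.univ_inter, Finset.sum_const,
    card_nbrs x τ hkn, nsmul_eq_mul]
  field_simp

theorem sum_smoother_transpose (k : ℕ) (j : Fin n) :
    ∑ i, smoother x τ k i j = reverseCount x τ k j / k := by
  simp only [smoother_apply, reverseCount]
  rw [← Finset.sum_filter, Finset.sum_const, nsmul_eq_mul, mul_one_div]

theorem smoother_one_mulVec (y : Fin n → ℝ) : smoother x τ 1 *ᵥ y = y := by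
  ext i
  have hn : 1 ≤ n := i.pos
  have h : nbrs x τ 1 i = {i} := by
    obtain ⟨a, ha⟩ := Finset.card_eq_one.1 (card_nbrs x τ hn i)
    have := self_mem_nbrs x τ le_rfl i
    rw [ha, Finset.mem_singleton] at this
    rw [ha, this]
  rw [smoother_mulVec, h]
  simp

theorem biasVec_one (i : Fin n) : biasVec x τ f 1 i = 0 := by
  rw [biasVec, smoother_one_mulVec, sub_self]

/-- The error of the `k`-nearest-neighbour estimator, as a function of the noise. -/
def estError (k : ℕ) (ε : Fin n → ℝ) (i : Fin n) : ℝ :=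
  biasVec x τ f k i + (smoother x τ k *ᵥ ε) i

theorem est_sub (k : ℕ) (ε : Fin n → ℝ) (i : Fin n) :
    est x τ k (response x f ε) i - f (x i) = estError x τ f k ε i := by
  have h : response x f ε = (fun j => f (x j)) + ε := rfl
  rw [est, h, Matrix.mulVec_add, estError, biasVec, Pi.add_apply]
  ring

theorem loss_eq (σ : ℝ) (ε : Fin n → ℝ) :
    loss x τ σ f ε
      = empNormSq (estError x τ f (minDiscrepancy x τ σ (response x f ε)) ε) := by
  unfold loss
  congr 1
  ext i
  exact est_sub x τ f _ ε i

/-- The empirical inner product of the smoothed noise with the noise. -/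
def noiseCross (k : ℕ) (ε : Fin n → ℝ) : ℝ :=
  quadForm (fun i j => smoother x τ k i j / n) ε

/-- The squared empirical norm of the smoothed noise. -/
def smoothedSq (k : ℕ) (ε : Fin n → ℝ) : ℝ :=
  quadForm (fun i j => (∑ l, smoother x τ k l i * smoother x τ k l j) / n) ε

/-- The empirical inner product of the bias with the noise. -/
def biasCross (k : ℕ) (ε : Fin n → ℝ) : ℝ := ∑ i, biasVec x τ f k i / n * ε i

theorem empNormSq_eq_quadForm (ε : Fin n → ℝ) :
    empNormSq ε = quadForm (fun i j => if i = j then 1 / (n : ℝ) else 0) ε := by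
  simp [empNormSq, quadForm, Finset.mul_sum, sq]

theorem noiseCross_eq (k : ℕ) (ε : Fin n → ℝ) :
    noiseCross x τ k ε = (1 / n) * ∑ i, (smoother x τ k *ᵥ ε) i * ε i := by
  simp only [noiseCross, quadForm, Matrix.mulVec, dotProduct, Finset.mul_sum, Finset.sum_mul]
  refine Finset.sum_congr rfl fun i _ => Finset.sum_congr rfl fun j _ => ?_
  ring

theorem smoothedSq_eq (k : ℕ) (ε : Fin n → ℝ) :
    smoothedSq x τ k ε = empNormSq (smoother x τ k *ᵥ ε) := by
  have h : ∀ l, (smoother x τ k *ᵥ ε) l ^ 2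
      = ∑ i, ∑ j, smoother x τ k l i * smoother x τ k l j * (ε i * ε j) := by
    intro l
    simp only [Matrix.mulVec, dotProduct, sq, Finset.sum_mul_sum]
    refine Finset.sum_congr rfl fun i _ => Finset.sum_congr rfl fun j _ => ?_
    ring
  have h2 : ∑ l, ∑ i, ∑ j, smoother x τ k l i * smoother x τ k l j * (ε i * ε j)
      = ∑ i, ∑ j, ∑ l, smoother x τ k l i * smoother x τ k l j * (ε i * ε j) := by
    rw [Finset.sum_comm]
    exact Finset.sum_congr rfl fun i _ => Finset.sum_comm
  simp only [smoothedSq, quadForm, empNormSq, h, h2, Finset.mul_sum, Finset.sum_mul,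
    Finset.sum_div]
  refine Finset.sum_congr rfl fun i _ => Finset.sum_congr rfl fun j _ =>
    Finset.sum_congr rfl fun l _ => ?_
  ring

/-- The empirical risk and the error differ by the squared norm of the noise and by an inner product
with the noise, which involves the smoother only linearly. -/
theorem empRisk_eq (k : ℕ) (ε : Fin n → ℝ) :
    empRisk x τ k (response x f ε) = empNormSq (estError x τ f k ε) + empNormSq ε
      - 2 * biasCross x τ f k ε - 2 * noiseCross x τ k ε := by
  have h : ∀ i, ((1 - smoother x τ k) *ᵥ response x f ε) i = ε i - estError x τ f k ε i := by
    intro i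
    have := est_sub x τ f k ε i
    rw [← this, Matrix.sub_mulVec, Matrix.one_mulVec, Pi.sub_apply, est, response]
    ring
  rw [noiseCross_eq]
  simp only [empRisk, empNormSq, h, biasCross]
  simp only [Finset.mul_sum, ← Finset.sum_add_distrib, ← Finset.sum_sub_distrib]
  refine Finset.sum_congr rfl fun i _ => ?_
  rw [estError]
  ring

/-- The weights favour the smoothed noise, because the bias will be a small fraction of it. -/
theorem empNormSq_estError_le (k : ℕ) (ε : Fin n → ℝ) :
    empNormSq (estError x τ f k ε)
      ≤ 5 / 4 * smoothedSq x τ k ε + 5 * empNormSq (biasVec x τ f k) := by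
  rw [smoothedSq_eq]
  simp only [empNormSq]
  have h : ∑ i, estError x τ f k ε i ^ 2
      ≤ 5 / 4 * ∑ i, (smoother x τ k *ᵥ ε) i ^ 2 + 5 * ∑ i, biasVec x τ f k i ^ 2 := by
    rw [Finset.mul_sum, Finset.mul_sum, ← Finset.sum_add_distrib]
    refine Finset.sum_le_sum fun i _ => ?_
    rw [estError]
    nlinarith [sq_nonneg (4 * biasVec x τ f k i - (smoother x τ k *ᵥ ε) i)]
  have := mul_le_mul_of_nonneg_left h (by positivity : (0 : ℝ) ≤ 1 / n)
  linarith

section Variances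

variable {σ : ℝ} {k : ℕ}

theorem integrable_sq_empNormSq_sub (c : ℝ) :
    Integrable (fun ε : Fin n → ℝ => (empNormSq ε - c) ^ 2) (noise n σ) := by
  simp only [empNormSq_eq_quadForm]
  exact integrable_quadForm_sub_sq _ _

theorem integral_sq_empNormSq_sub_le (hn : 1 ≤ n) :
    ∫ ε : Fin n → ℝ, (empNormSq ε - σ ^ 2) ^ 2 ∂(noise n σ) ≤ 2 * (σ ^ 2) ^ 2 / n := by
  have hn0 : (n : ℝ) ≠ 0 := by positivity
  have h := integral_quadForm_sub_sq_le (σ := σ)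
    (fun i j : Fin n => if i = j then 1 / (n : ℝ) else 0)
  simp only [← empNormSq_eq_quadForm, if_true, Finset.sum_const, Finset.card_univ,
    Fintype.card_fin, nsmul_eq_mul, ite_pow, zero_pow two_ne_zero, Finset.sum_ite_eq,
    Finset.mem_univ] at h
  rw [mul_one_div_cancel hn0, mul_one] at h
  refine h.trans_eq ?_
  field_simp

theorem integrable_sq_noiseCross_sub (c : ℝ) :
    Integrable (fun ε : Fin n → ℝ => (noiseCross x τ k ε - c) ^ 2) (noise n σ) :=
  integrable_quadForm_sub_sq _ _

theorem integral_sq_noiseCross_sub_le (hk : 1 ≤ k) (hkn : k ≤ n) :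
    ∫ ε : Fin n → ℝ, (noiseCross x τ k ε - σ ^ 2 / k) ^ 2 ∂(noise n σ)
      ≤ 2 * (σ ^ 2) ^ 2 / (n * k) := by
  have hn : 1 ≤ n := hk.trans hkn
  have hn0 : (n : ℝ) ≠ 0 := by positivity
  have hk0 : (k : ℝ) ≠ 0 := by positivity
  have h := integral_quadForm_sub_sq_le (σ := σ) (fun i j : Fin n => smoother x τ k i j / n)
  have htr : ∑ i : Fin n, smoother x τ k i i / n = 1 / k := by
    simp only [smoother_apply, self_mem_nbrs x τ hk, if_true, Finset.sum_const, Finset.card_univ,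
      Fintype.card_fin, nsmul_eq_mul]
    field_simp
  have hfr : ∑ i : Fin n, ∑ j : Fin n, (smoother x τ k i j / n) ^ 2 = 1 / (n * k) := by
    simp only [div_pow, ← Finset.sum_div, sum_smoother_sq x τ hk hkn, Finset.sum_const,
      Finset.card_univ, Fintype.card_fin, nsmul_eq_mul]
    field_simp
  rw [htr, hfr, mul_one_div, mul_one_div] at h
  exact h

theorem integrable_sq_smoothedSq_sub (c : ℝ) :
    Integrable (fun ε : Fin n → ℝ => (smoothedSq x τ k ε - c) ^ 2) (noise n σ) :=
  integrable_quadForm_sub_sq _ _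

/-- The squared Frobenius norm of `Aᵀ A`: its entries in row `i` are at most `c i / k ^ 2` and add
up to `c i / k`, where `c i` is the number of points that have `i` among their neighbours. -/
theorem sum_sq_gram_le (hk : 1 ≤ k) (hkn : k ≤ n) :
    ∑ i, ∑ j, (∑ l, smoother x τ k l i * smoother x τ k l j) ^ 2
      ≤ (∑ j, (reverseCount x τ k j : ℝ) ^ 2) / k ^ 3 := by
  rw [Finset.sum_div]
  refine Finset.sum_le_sum fun i _ => ?_
  set c : ℝ := (reverseCount x τ k i : ℝ) with hc
  have hG0 : ∀ j, 0 ≤ ∑ l, smoother x τ k l i * smoother x τ k l j := fun j =>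
    Finset.sum_nonneg fun l _ => mul_nonneg (smoother_nonneg x τ k l i) (smoother_nonneg x τ k l j)
  have hG1 : ∀ j, ∑ l, smoother x τ k l i * smoother x τ k l j ≤ c / k * (1 / k) := by
    intro j
    rw [hc, ← sum_smoother_transpose, Finset.sum_mul]
    exact Finset.sum_le_sum fun l _ =>
      mul_le_mul_of_nonneg_left (smoother_le x τ k l j) (smoother_nonneg x τ k l i)
  have hG2 : ∑ j, ∑ l, smoother x τ k l i * smoother x τ k l j = c / k := by
    rw [Finset.sum_comm]
    simp only [← Finset.mul_sum, sum_smoother x τ hk hkn, mul_one]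
    rw [hc, ← sum_smoother_transpose]
  calc ∑ j, (∑ l, smoother x τ k l i * smoother x τ k l j) ^ 2
      ≤ ∑ j, (c / k * (1 / k)) * ∑ l, smoother x τ k l i * smoother x τ k l j :=
        Finset.sum_le_sum fun j _ => by
          rw [sq]
          exact mul_le_mul_of_nonneg_right (hG1 j) (hG0 j)
    _ = c ^ 2 / k ^ 3 := by
        rw [← Finset.mul_sum, hG2]
        ring

theorem integral_sq_smoothedSq_sub_le (hk : 1 ≤ k) (hkn : k ≤ n) :
    ∫ ε : Fin n → ℝ, (smoothedSq x τ k ε - σ ^ 2 / k) ^ 2 ∂(noise n σ)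
      ≤ 2 * (σ ^ 2) ^ 2 * ((∑ j, (reverseCount x τ k j : ℝ) ^ 2) / k ^ 3 / n ^ 2) := by
  have hn : 1 ≤ n := hk.trans hkn
  have hn0 : (n : ℝ) ≠ 0 := by positivity
  have hk0 : (k : ℝ) ≠ 0 := by positivity
  have h := integral_quadForm_sub_sq_le (σ := σ)
    (fun i j : Fin n => (∑ l, smoother x τ k l i * smoother x τ k l j) / n)
  have htr : ∑ i : Fin n, (∑ l, smoother x τ k l i * smoother x τ k l i) / n = 1 / k := by
    rw [← Finset.sum_div, Finset.sum_comm]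
    simp only [← sq, sum_smoother_sq x τ hk hkn, Finset.sum_const, Finset.card_univ,
      Fintype.card_fin, nsmul_eq_mul]
    field_simp
  rw [htr, mul_one_div] at h
  refine h.trans (mul_le_mul_of_nonneg_left ?_ (by positivity))
  simp only [div_pow, ← Finset.sum_div]
  exact div_le_div_of_nonneg_right (sum_sq_gram_le x τ hk hkn) (by positivity)

theorem integrable_sq_biasCross :
    Integrable (fun ε : Fin n → ℝ => biasCross x τ f k ε ^ 2) (noise n σ) :=
  integrable_sq_sum_mul _

theorem integral_sq_biasCross :
    ∫ ε : Fin n → ℝ, biasCross x τ f k ε ^ 2 ∂(noise n σ)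
      = σ ^ 2 * empNormSq (biasVec x τ f k) / n := by
  unfold biasCross
  rw [integral_sq_sum_mul]
  simp only [div_pow, ← Finset.sum_div, empNormSq]
  ring

theorem integrable_exp_mul_biasCross (t : ℝ) :
    Integrable (fun ε : Fin n → ℝ => Real.exp (t * biasCross x τ f k ε)) (noise n σ) := by
  simp only [biasCross, Finset.mul_sum, ← mul_assoc]
  exact integrable_exp_sum_mul _

theorem integral_exp_mul_biasCross (t : ℝ) :
    ∫ ε : Fin n → ℝ, Real.exp (t * biasCross x τ f k ε) ∂(noise n σ)
      = Real.exp (t ^ 2 / n * (σ ^ 2 * empNormSq (biasVec x τ f k) / 2)) := by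
  simp only [biasCross, Finset.mul_sum, ← mul_assoc]
  rw [integral_exp_sum_mul]
  congr 1
  simp only [mul_pow, div_pow, ← Finset.sum_div, ← Finset.mul_sum, empNormSq]
  ring

end Variances

section StoppingRule

variable (σ : ℝ)

theorem minDiscrepancy_mem (hn : 1 ≤ n) (Y : Fin n → ℝ) :
    1 ≤ minDiscrepancy x τ σ Y ∧ minDiscrepancy x τ σ Y ≤ n ∧
      empRisk x τ (minDiscrepancy x τ σ Y) Y ≤ σ ^ 2 := by
  refine Nat.sSup_mem (s := {k : ℕ | 1 ≤ k ∧ k ≤ n ∧ empRisk x τ k Y ≤ σ ^ 2})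
    ⟨1, le_rfl, hn, ?_⟩ ⟨n, fun k hk => hk.2.1⟩
  -- the one-nearest-neighbour estimator interpolates the data
  rw [empRisk, Matrix.sub_mulVec, Matrix.one_mulVec, smoother_one_mulVec, sub_self]
  simpa [empNormSq] using sq_nonneg σ

theorem le_minDiscrepancy {Y : Fin n → ℝ} {k : ℕ} (hk : 1 ≤ k) (hkn : k ≤ n)
    (h : empRisk x τ k Y ≤ σ ^ 2) : k ≤ minDiscrepancy x τ σ Y :=
  le_csSup ⟨n, fun _ hk => hk.2.1⟩ ⟨hk, hkn, h⟩

theorem continuous_mulVec (k : ℕ) (i : Fin n) :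
    Continuous fun ε : Fin n → ℝ => (smoother x τ k *ᵥ ε) i := by
  simp only [Matrix.mulVec, dotProduct]
  fun_prop

theorem measurable_empNormSq_estError (k : ℕ) :
    Measurable fun ε : Fin n → ℝ => empNormSq (estError x τ f k ε) := by
  have := continuous_mulVec x τ k
  simp only [empNormSq, estError]
  exact (by fun_prop : Continuous _).measurable

theorem measurable_empRisk_response (k : ℕ) :
    Measurable fun ε : Fin n → ℝ => empRisk x τ k (response x f ε) := by
  have := continuous_mulVec x τ k
  simp only [empRisk, empNormSq, response, Matrix.mulVec, dotProduct]
  exact (by fun_prop : Continuous _).measurable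

theorem measurable_minDiscrepancy (hn : 1 ≤ n) :
    Measurable fun ε : Fin n → ℝ => minDiscrepancy x τ σ (response x f ε) := by
  refine measurable_of_Ici fun m => ?_
  have : (fun ε : Fin n → ℝ => minDiscrepancy x τ σ (response x f ε)) ⁻¹' Set.Ici m
      = ⋃ k ∈ {k | 1 ≤ k ∧ k ≤ n ∧ m ≤ k}, {ε | empRisk x τ k (response x f ε) ≤ σ ^ 2} := by
    ext ε
    simp only [Set.mem_preimage, Set.mem_Ici, Set.mem_iUnion, Set.mem_ofPred_eq]
    constructor
    · intro h
      have := minDiscrepancy_mem x τ σ hn (response x f ε)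
      exact ⟨_, ⟨this.1, this.2.1, h⟩, this.2.2⟩
    · rintro ⟨k, ⟨h1, h2, h3⟩, h4⟩
      exact h3.trans (le_minDiscrepancy x τ σ h1 h2 h4)
  rw [this]
  exact MeasurableSet.biUnion (Set.to_countable _) fun k _ =>
    measurableSet_le (measurable_empRisk_response x τ f k) measurable_const

theorem measurable_loss (hn : 1 ≤ n) : Measurable (loss x τ σ f) := by
  have h : Measurable fun p : ℕ × (Fin n → ℝ) => empNormSq (estError x τ f p.1 p.2) :=
    measurable_from_prod_countable_right fun k => measurable_empNormSq_estError x τ f k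
  have h2 := h.comp ((measurable_minDiscrepancy x τ f σ hn).prodMk measurable_id)
  have h3 : loss x τ σ f = (fun p : ℕ × (Fin n → ℝ) => empNormSq (estError x τ f p.1 p.2)) ∘
      fun ε => (minDiscrepancy x τ σ (response x f ε), id ε) := by
    ext ε
    exact loss_eq x τ f σ ε
  rw [h3]
  exact h2

theorem empNormSq_nonneg (v : Fin n → ℝ) : 0 ≤ empNormSq v :=
  mul_nonneg (by positivity) (Finset.sum_nonneg fun _ _ => sq_nonneg _)

/-- At the stopping time the risk is at most `σ²`, which bounds the loss by fluctuations linear in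
the smoother and by the variance at the stopping time. -/
theorem loss_le (hn : 1 ≤ n) (ε : Fin n → ℝ) : ∃ k, 1 ≤ k ∧ k ≤ n ∧
    k = minDiscrepancy x τ σ (response x f ε) ∧
    loss x τ σ f ε ≤ |empNormSq ε - σ ^ 2| + 2 * σ ^ 2 * (1 / k)
      + 2 * |noiseCross x τ k ε - σ ^ 2 / k| + 2 * |biasCross x τ f k ε| := by
  have h := minDiscrepancy_mem x τ σ hn (response x f ε)
  refine ⟨_, h.1, h.2.1, rfl, ?_⟩
  rw [loss_eq]
  set k := minDiscrepancy x τ σ (response x f ε)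
  have h1 := h.2.2
  rw [empRisk_eq] at h1
  have h2 := neg_abs_le (empNormSq ε - σ ^ 2)
  have h3 := le_abs_self (noiseCross x τ k ε - σ ^ 2 / k)
  have h4 := le_abs_self (biasCross x τ f k ε)
  have h5 : 2 * σ ^ 2 * (1 / (k : ℝ)) = 2 * (σ ^ 2 / k) := by ring
  linarith

end StoppingRule

end

/-! ### The expected loss and its comparison with a fixed number of neighbours -/

section

/-- `g` is integrable and its integral is at most `c`. -/
def IntegralLE {Ω : Type*} [MeasurableSpace Ω] (μ : Measure Ω) (g : Ω → ℝ) (c : ℝ) : Prop :=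
  Integrable g μ ∧ ∫ ω, g ω ∂μ ≤ c

namespace IntegralLE

variable {Ω : Type*} [MeasurableSpace Ω] {μ : Measure Ω} {g h : Ω → ℝ} {b c : ℝ}

theorem add (hg : IntegralLE μ g b) (hh : IntegralLE μ h c) :
    IntegralLE μ (fun ω => g ω + h ω) (b + c) :=
  ⟨hg.1.add hh.1, (integral_add hg.1 hh.1).trans_le (add_le_add hg.2 hh.2)⟩

theorem const_mul {a : ℝ} (ha : 0 ≤ a) (hg : IntegralLE μ g b) :
    IntegralLE μ (fun ω => a * g ω) (a * b) :=
  ⟨hg.1.const_mul a, (integral_const_mul a _).trans_le (mul_le_mul_of_nonneg_left hg.2 ha)⟩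

theorem const [IsProbabilityMeasure μ] (a : ℝ) : IntegralLE μ (fun _ => a) a :=
  ⟨integrable_const a, by simp⟩

theorem sum {ι : Type*} {s : Finset ι} {g : ι → Ω → ℝ} {b : ι → ℝ}
    (hg : ∀ i ∈ s, IntegralLE μ (g i) (b i)) :
    IntegralLE μ (fun ω => ∑ i ∈ s, g i ω) (∑ i ∈ s, b i) :=
  ⟨integrable_finsetSum _ fun i hi => (hg i hi).1,
    (integral_finsetSum _ fun i hi => (hg i hi).1).trans_le
      (Finset.sum_le_sum fun i hi => (hg i hi).2)⟩

theorem mono (hg : IntegralLE μ g b) (hm : Measurable h) (h0 : ∀ ω, 0 ≤ h ω)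
    (hle : ∀ ω, h ω ≤ g ω) : IntegralLE μ h b := by
  have hi : Integrable h μ := hg.1.mono' hm.aestronglyMeasurable
    (Filter.Eventually.of_forall fun ω => by
      rw [Real.norm_eq_abs, abs_of_nonneg (h0 ω)]
      exact hle ω)
  exact ⟨hi, (integral_mono hi hg.1 hle).trans hg.2⟩

theorem weaken (hg : IntegralLE μ g b) (h : b ≤ c) : IntegralLE μ g c := ⟨hg.1, hg.2.trans h⟩

end IntegralLE

/-- The inequality between arithmetic and geometric means, which trades a first moment for a second
one. -/
theorem abs_le_add_mul_sq {N : ℝ} (hN : 0 < N) (a : ℝ) : |a| ≤ 1 / 2 * (1 / N + N * a ^ 2) := by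
  have h : 1 / 2 * (1 / N + N * a ^ 2) - |a| = N / 2 * (1 / N - |a|) ^ 2 := by
    rw [← sq_abs a]
    field_simp
    ring
  have : 0 ≤ N / 2 * (1 / N - |a|) ^ 2 := by positivity
  linarith

/-- With `exp y` replaced by a sum of exponentials, this bounds the expected maximum of finitely
many variables by their exponential moments. -/
theorem le_log_add_exp_div {K y : ℝ} (hK : 0 < K) : y ≤ Real.log K + Real.exp y / K := by
  have h := Real.add_one_le_exp (y - Real.log K)
  rw [Real.exp_sub, Real.exp_log hK] at h
  linarith

variable {d n : ℕ} (x : Fin n → EuclideanSpace ℝ (Fin d)) (τ : Ties n)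
  (f : EuclideanSpace ℝ (Fin d) → ℝ) (σ : ℝ)

/-- An upper bound for the indicator of the event that the risk at `k` exceeds `σ²`. With
`s = σ² / k`, its terms are at least one when `‖A ε‖²` deviates from `s` by `s / 5`, when `⟨A ε, ε⟩`
does by `s / 20`, when `⟨b, ε⟩` deviates from zero by `s / 20`, and when `‖ε‖²` exceeds
`σ² + s / 10`. The parameter `θ = 1 / (40 k)` of the exponential minimizes
`2 θ² - θ / (10 k)`, the exponent per observation in the resulting bound. -/
def failureBound (k : ℕ) (ε : Fin n → ℝ) : ℝ :=
  (5 * k / σ ^ 2) ^ 2 * (smoothedSq x τ k ε - σ ^ 2 / k) ^ 2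
    + (20 * k / σ ^ 2) ^ 2 * (noiseCross x τ k ε - σ ^ 2 / k) ^ 2
    + (20 * k / σ ^ 2) ^ 2 * biasCross x τ f k ε ^ 2
    + Real.exp (-(n * (1 / (40 * k) + 1 / (400 * k ^ 2))))
      * Real.exp (1 / (40 * k) / σ ^ 2 * ∑ i, ε i ^ 2)

theorem abs_lt_of_sq_mul_sq_lt_one {a c : ℝ} (hc : 0 < c) (h : c ^ 2 * a ^ 2 < 1) :
    |a| < 1 / c := by
  rw [lt_div_iff₀ hc, ← abs_of_pos hc, ← abs_mul]
  refine (sq_lt_one_iff_abs_lt_one _).1 ?_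
  rw [mul_pow, mul_comm]
  exact h

/-- If all terms of `failureBound` are less than one and the squared bias is at most `s / 100`,
where `s = σ² / k`, then the risk is at most `σ² - 3 s / 20`. -/
theorem one_le_failureBound {σ : ℝ} (hσ : 0 < σ) {k : ℕ} (hk : 1 ≤ k) (hkn : k ≤ n)
    (hb : empNormSq (biasVec x τ f k) ≤ σ ^ 2 / (100 * k)) {ε : Fin n → ℝ}
    (h : σ ^ 2 < empRisk x τ k (response x f ε)) : 1 ≤ failureBound x τ f σ k ε := by
  by_contra! hW
  have hk0 : (0 : ℝ) < k := by exact_mod_cast hk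
  have hn0 : (0 : ℝ) < n := by exact_mod_cast (hk.trans hkn)
  have hs : 0 < σ ^ 2 := pow_pos hσ 2
  unfold failureBound at hW
  have p1 : 0 ≤ (5 * k / σ ^ 2) ^ 2 * (smoothedSq x τ k ε - σ ^ 2 / k) ^ 2 := by positivity
  have p2 : 0 ≤ (20 * k / σ ^ 2) ^ 2 * (noiseCross x τ k ε - σ ^ 2 / k) ^ 2 := by positivity
  have p3 : 0 ≤ (20 * k / σ ^ 2) ^ 2 * biasCross x τ f k ε ^ 2 := by positivity
  have p4 : 0 ≤ Real.exp (-(n * (1 / (40 * k) + 1 / (400 * k ^ 2))))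
      * Real.exp (1 / (40 * k) / σ ^ 2 * ∑ i, ε i ^ 2) := by positivity
  have h1 := abs_lt_of_sq_mul_sq_lt_one (c := 5 * k / σ ^ 2) (by positivity)
    (a := smoothedSq x τ k ε - σ ^ 2 / k) (by linarith)
  have h2 := abs_lt_of_sq_mul_sq_lt_one (c := 20 * k / σ ^ 2) (by positivity)
    (a := noiseCross x τ k ε - σ ^ 2 / k) (by linarith)
  have h3 := abs_lt_of_sq_mul_sq_lt_one (c := 20 * k / σ ^ 2) (by positivity)
    (a := biasCross x τ f k ε) (by linarith)
  have h4 : Real.exp (-(n * (1 / (40 * k) + 1 / (400 * k ^ 2)))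
      + 1 / (40 * k) / σ ^ 2 * ∑ i, ε i ^ 2) < 1 := by
    rw [Real.exp_add]
    linarith
  rw [Real.exp_lt_one_iff] at h4
  have h5 : empNormSq ε < σ ^ 2 + (σ ^ 2 / k) / 10 := by
    have h6 : empNormSq ε = (40 * k * σ ^ 2 / n) * (1 / (40 * k) / σ ^ 2 * ∑ i, ε i ^ 2) := by
      rw [empNormSq]
      field_simp
    have h7 : σ ^ 2 + (σ ^ 2 / k) / 10
        = (40 * k * σ ^ 2 / n) * (n * (1 / (40 * k) + 1 / (400 * k ^ 2))) := by
      field_simp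
      ring
    rw [h6, h7]
    exact mul_lt_mul_of_pos_left (by linarith) (by positivity)
  have e1 : 1 / (5 * k / σ ^ 2) = (σ ^ 2 / k) / 5 := by field_simp
  have e2 : 1 / (20 * k / σ ^ 2) = (σ ^ 2 / k) / 20 := by field_simp
  have e3 : σ ^ 2 / (100 * k) = (σ ^ 2 / k) / 100 := by field_simp
  rw [e1] at h1
  rw [e2] at h2 h3
  rw [e3] at hb
  have hs' : 0 < σ ^ 2 / k := by positivity
  rw [empRisk_eq] at h
  have h8 := empNormSq_estError_le x τ f k ε
  have h9 := (abs_lt.1 h1).2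
  have h10 := (abs_lt.1 h2).1
  have h11 := (abs_lt.1 h3).1
  linarith

theorem failureBound_nonneg (k : ℕ) (ε : Fin n → ℝ) : 0 ≤ failureBound x τ f σ k ε := by
  unfold failureBound
  positivity

/-- The stopping time is at least `k`, unless the risk at `k` exceeds `σ²`. -/
theorem one_div_minDiscrepancy_le {σ : ℝ} (hσ : 0 < σ) {k : ℕ} (hk : 1 ≤ k) (hkn : k ≤ n)
    (hb : empNormSq (biasVec x τ f k) ≤ σ ^ 2 / (100 * k)) (ε : Fin n → ℝ) :
    1 / (minDiscrepancy x τ σ (response x f ε) : ℝ) ≤ 1 / k + failureBound x τ f σ k ε := by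
  have hk0 : (0 : ℝ) < k := by exact_mod_cast hk
  by_cases h : empRisk x τ k (response x f ε) ≤ σ ^ 2
  · have h1 : (k : ℝ) ≤ minDiscrepancy x τ σ (response x f ε) := by
      exact_mod_cast le_minDiscrepancy x τ σ hk hkn h
    have := one_div_le_one_div_of_le hk0 h1
    linarith [failureBound_nonneg x τ f σ k ε]
  · have h1 := one_le_failureBound x τ f hσ hk hkn hb (not_le.1 h)
    have h2 : (1 : ℝ) ≤ minDiscrepancy x τ σ (response x f ε) := by
      exact_mod_cast (minDiscrepancy_mem x τ σ (hk.trans hkn) (response x f ε)).1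
    have h3 := one_div_le_one_div_of_le one_pos h2
    have h4 : (0 : ℝ) < 1 / k := by positivity
    linarith

theorem integralLE_failureBound {σ : ℝ} (hσ : 0 < σ) {k : ℕ} (hk : 1 ≤ k) (hkn : k ≤ n)
    (hb : empNormSq (biasVec x τ f k) ≤ σ ^ 2 / (100 * k)) :
    IntegralLE (noise n σ) (failureBound x τ f σ k)
      (50 * (∑ j, (reverseCount x τ k j : ℝ) ^ 2) / (k * n ^ 2) + 804 * (k / n)
        + Real.exp (-(n / (800 * k ^ 2)))) := by
  have hk0 : (0 : ℝ) < k := by exact_mod_cast hk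
  have hk1 : (1 : ℝ) ≤ k := by exact_mod_cast hk
  have hn0 : (0 : ℝ) < n := by exact_mod_cast (hk.trans hkn)
  have hs : 0 < σ ^ 2 := pow_pos hσ 2
  have hθ : (1 : ℝ) / (40 * k) ≤ 1 / 6 := one_div_le_one_div_of_le (by norm_num) (by linarith)
  have t1 : IntegralLE (noise n σ) (fun ε => (smoothedSq x τ k ε - σ ^ 2 / k) ^ 2) _ :=
    ⟨integrable_sq_smoothedSq_sub x τ _, integral_sq_smoothedSq_sub_le x τ hk hkn⟩
  have t2 : IntegralLE (noise n σ) (fun ε => (noiseCross x τ k ε - σ ^ 2 / k) ^ 2) _ :=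
    ⟨integrable_sq_noiseCross_sub x τ _, integral_sq_noiseCross_sub_le x τ hk hkn⟩
  have t3 : IntegralLE (noise n σ) (fun ε => biasCross x τ f k ε ^ 2) _ :=
    ⟨integrable_sq_biasCross x τ f, (integral_sq_biasCross x τ f).le⟩
  have t4 : IntegralLE (noise n σ)
      (fun ε => Real.exp (1 / (40 * k) / σ ^ 2 * ∑ i, ε i ^ 2)) _ :=
    ⟨integrable_exp_mul_sum_sq hσ (by linarith),
      integral_exp_mul_sum_sq_le hσ (by positivity) hθ⟩
  have ht := (((t1.const_mul (sq_nonneg (5 * k / σ ^ 2))).add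
    (t2.const_mul (sq_nonneg (20 * k / σ ^ 2)))).add
    (t3.const_mul (sq_nonneg (20 * k / σ ^ 2)))).add
    (t4.const_mul (Real.exp_pos (-(n * (1 / (40 * k) + 1 / (400 * k ^ 2))))).le)
  refine ht.weaken ?_
  have e1 : (5 * k / σ ^ 2) ^ 2 * (2 * (σ ^ 2) ^ 2 *
      ((∑ j, (reverseCount x τ k j : ℝ) ^ 2) / k ^ 3 / n ^ 2))
      = 50 * (∑ j, (reverseCount x τ k j : ℝ) ^ 2) / (k * n ^ 2) := by
    field_simp
    ring
  have e2 : (20 * k / σ ^ 2) ^ 2 * (2 * (σ ^ 2) ^ 2 / (n * k)) = 800 * (k / n) := by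
    field_simp
    ring
  have e3 : (20 * k / σ ^ 2) ^ 2 * (σ ^ 2 * empNormSq (biasVec x τ f k) / n) ≤ 4 * (k / n) := by
    calc _ ≤ (20 * k / σ ^ 2) ^ 2 * (σ ^ 2 * (σ ^ 2 / (100 * k)) / n) := by gcongr
      _ = 4 * (k / n) := by
        field_simp
        ring
  have e4 : Real.exp (-(n * (1 / (40 * k) + 1 / (400 * k ^ 2))))
      * Real.exp (n * (1 / (40 * k) + 2 * (1 / (40 * k)) ^ 2))
      = Real.exp (-(n / (800 * k ^ 2))) := by
    rw [← Real.exp_add]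
    congr 1
    field_simp
    ring
  rw [e1, e2, e4]
  linarith

theorem integralLE_sum_exp_biasCross {L : ℝ≥0} (hf : LipschitzOnWith L f (cube d))
    (hx : ∀ i, x i ∈ cube d) (hn : 1 ≤ n) :
    IntegralLE (noise n σ) (fun ε => ∑ k ∈ Finset.Icc 1 n,
      (Real.exp (√n * biasCross x τ f k ε) + Real.exp (-√n * biasCross x τ f k ε)))
      (2 * n * Real.exp (σ ^ 2 * (L ^ 2 * d) / 2)) := by
  have hn0 : (0 : ℝ) < n := by exact_mod_cast hn
  have h1 : ∀ k ∈ Finset.Icc 1 n, ∀ t : ℝ, t ^ 2 = n → IntegralLE (noise n σ)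
      (fun ε => Real.exp (t * biasCross x τ f k ε)) (Real.exp (σ ^ 2 * (L ^ 2 * d) / 2)) := by
    intro k hk t ht
    rw [Finset.mem_Icc] at hk
    refine ⟨integrable_exp_mul_biasCross x τ f t, ?_⟩
    rw [integral_exp_mul_biasCross, ht, div_self hn0.ne', one_mul]
    have h2 : empNormSq (biasVec x τ f k) ≤ L ^ 2 * d := by
      rw [empNormSq, one_div_mul_eq_div, div_le_iff₀ hn0, mul_comm]
      exact sum_sq_biasVec_le_dim x τ hf hx hk.1 hk.2
    refine Real.exp_le_exp.2 ?_
    gcongr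
  have h2 := IntegralLE.sum fun k hk => (h1 k hk (√n) (Real.sq_sqrt hn0.le)).add
    (h1 k hk (-√n) (by rw [neg_sq, Real.sq_sqrt hn0.le]))
  refine h2.weaken (le_of_eq ?_)
  rw [Finset.sum_const, Nat.card_Icc, nsmul_eq_mul, Nat.add_sub_cancel]
  ring

theorem sum_Icc_one_div_le (n : ℕ) : ∑ k ∈ Finset.Icc 1 n, 1 / (k : ℝ) ≤ 1 + Real.log n := by
  have h := harmonic_le_one_add_log n
  rw [harmonic_eq_sum_Icc] at h
  simpa using h

/-- The expected loss is bounded, up to fluctuations of order `log n / √n`, by the variance at any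
`k` whose squared bias is a small fraction of the variance. -/
theorem integralLE_loss {σ : ℝ} (hσ : 0 < σ) {L : ℝ≥0} (hf : LipschitzOnWith L f (cube d))
    (hx : ∀ i, x i ∈ cube d) {k : ℕ} (hk : 1 ≤ k) (hkn : k ≤ n)
    (hb : empNormSq (biasVec x τ f k) ≤ σ ^ 2 / (100 * k)) :
    IntegralLE (noise n σ) (loss x τ σ f)
      ((6 + 3 * (σ ^ 2) ^ 2 + 2 * Real.exp (σ ^ 2 * (L ^ 2 * d) / 2))
          * (1 / √n * (1 + Real.log n))
        + 2 * σ ^ 2 * (1 / k + (50 * (∑ j, (reverseCount x τ k j : ℝ) ^ 2) / (k * n ^ 2)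
          + 804 * (k / n) + Real.exp (-(n / (800 * k ^ 2)))))) := by
  have hn : 1 ≤ n := hk.trans hkn
  have hn0 : (0 : ℝ) < n := by exact_mod_cast hn
  have hn1 : (1 : ℝ) ≤ n := by exact_mod_cast hn
  have hN : 0 < √(n : ℝ) := Real.sqrt_pos.2 hn0
  have hNn : √(n : ℝ) * √n = n := Real.mul_self_sqrt hn0.le
  have tA : IntegralLE (noise n σ) (fun ε : Fin n → ℝ => (empNormSq ε - σ ^ 2) ^ 2) _ :=
    ⟨integrable_sq_empNormSq_sub _, integral_sq_empNormSq_sub_le hn⟩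
  have tC : IntegralLE (noise n σ) (fun ε => ∑ k ∈ Finset.Icc 1 n,
      (noiseCross x τ k ε - σ ^ 2 / k) ^ 2) _ := IntegralLE.sum fun k hk =>
    ⟨integrable_sq_noiseCross_sub x τ _, integral_sq_noiseCross_sub_le x τ (Finset.mem_Icc.1 hk).1
      (Finset.mem_Icc.1 hk).2⟩
  have tD := integralLE_sum_exp_biasCross x τ f σ hf hx hn
  have tW := integralLE_failureBound x τ f hσ hk hkn hb
  -- the four summands bound the fluctuations of `‖ε‖²`, the variance at the stopping time, and the
  -- largest fluctuations over `k` of `⟨A ε, ε⟩` and of `⟨b, ε⟩`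
  have hall := ((((((tA.const_mul hN.le).add (IntegralLE.const (1 / √n))).const_mul
      (by norm_num : (0 : ℝ) ≤ 1 / 2)).add
    (((IntegralLE.const (1 / (k : ℝ))).add tW).const_mul (by positivity : 0 ≤ 2 * σ ^ 2))).add
    ((tC.const_mul hN.le).add (IntegralLE.const (1 / √n)))).add
    (((IntegralLE.const (Real.log (2 * n))).add
      (tD.const_mul (by positivity : (0 : ℝ) ≤ 1 / (2 * n)))).const_mul
      (by positivity : 0 ≤ 2 * (1 / √(n : ℝ)))))
  refine (hall.mono (measurable_loss x τ f σ hn) (fun ε => ?_) (fun ε => ?_)).weaken ?_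
  · rw [loss_eq]
    exact empNormSq_nonneg _
  · obtain ⟨k', hk1, hk2, hk3, hle⟩ := loss_le x τ f σ hn ε
    have hk' : k' ∈ Finset.Icc 1 n := Finset.mem_Icc.2 ⟨hk1, hk2⟩
    have h1 := abs_le_add_mul_sq hN (empNormSq ε - σ ^ 2)
    have h2 := one_div_minDiscrepancy_le x τ f hσ hk hkn hb ε
    rw [← hk3] at h2
    have h3 := abs_le_add_mul_sq hN (noiseCross x τ k' ε - σ ^ 2 / k')
    have h4 : (noiseCross x τ k' ε - σ ^ 2 / k') ^ 2
        ≤ ∑ k ∈ Finset.Icc 1 n, (noiseCross x τ k ε - σ ^ 2 / k) ^ 2 :=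
      Finset.single_le_sum (f := fun k : ℕ => (noiseCross x τ k ε - σ ^ 2 / k) ^ 2)
        (fun _ _ => sq_nonneg _) hk'
    have h5 : Real.exp (√n * |biasCross x τ f k' ε|) ≤ ∑ k ∈ Finset.Icc 1 n,
        (Real.exp (√n * biasCross x τ f k ε) + Real.exp (-√n * biasCross x τ f k ε)) := by
      refine le_trans ?_ (Finset.single_le_sum (f := fun k : ℕ =>
        Real.exp (√n * biasCross x τ f k ε) + Real.exp (-√n * biasCross x τ f k ε))
        (fun _ _ => by positivity) hk')
      have p1 := Real.exp_pos (√n * biasCross x τ f k' ε)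
      have p2 := Real.exp_pos (-√n * biasCross x τ f k' ε)
      rcases abs_cases (biasCross x τ f k' ε) with ⟨h, -⟩ | ⟨h, -⟩
      · rw [h]
        linarith
      · rw [h, mul_neg, ← neg_mul]
        linarith
    have h6 := le_log_add_exp_div (K := 2 * n) (y := √n * |biasCross x τ f k' ε|) (by positivity)
    have h7 := div_le_div_of_nonneg_right h5 (by positivity : (0 : ℝ) ≤ 2 * n)
    have h8 : |biasCross x τ f k' ε| = 1 / √n * (√n * |biasCross x τ f k' ε|) := by
      field_simp
    have h9 : |biasCross x τ f k' ε| ≤ 1 / √n * (Real.log (2 * n) + 1 / (2 * n) *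
        ∑ k ∈ Finset.Icc 1 n,
        (Real.exp (√n * biasCross x τ f k ε) + Real.exp (-√n * biasCross x τ f k ε))) := by
      rw [h8, one_div_mul_eq_div (2 * (n : ℝ))]
      exact mul_le_mul_of_nonneg_left (by linarith) (by positivity)
    have h10 := mul_le_mul_of_nonneg_left h2 (by positivity : 0 ≤ 2 * σ ^ 2)
    have h11 := mul_le_mul_of_nonneg_left h4 hN.le
    linarith
  · have e1 : ∑ k ∈ Finset.Icc 1 n, 2 * (σ ^ 2) ^ 2 / ((n : ℝ) * k)
        ≤ 2 * (σ ^ 2) ^ 2 / n * (1 + Real.log n) := by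
      have : ∑ k ∈ Finset.Icc 1 n, 2 * (σ ^ 2) ^ 2 / ((n : ℝ) * k)
          = 2 * (σ ^ 2) ^ 2 / n * ∑ k ∈ Finset.Icc 1 n, 1 / (k : ℝ) := by
        rw [Finset.mul_sum]
        exact Finset.sum_congr rfl fun k _ => by ring
      rw [this]
      exact mul_le_mul_of_nonneg_left (sum_Icc_one_div_le n) (by positivity)
    have e2 : Real.log (2 * n) ≤ 1 + Real.log n := by
      rw [Real.log_mul two_ne_zero hn0.ne']
      have := Real.log_two_lt_d9
      linarith
    have hlog : 0 ≤ Real.log n := Real.log_nonneg hn1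
    have e3 : √(n : ℝ) / n = 1 / √n := by
      rw [div_eq_div_iff hn0.ne' hN.ne', hNn, one_mul]
    have e4 : √(n : ℝ) * (2 * (σ ^ 2) ^ 2 / n) = 2 * (σ ^ 2) ^ 2 * (1 / √n) := by
      rw [← e3]
      ring
    have e5 := mul_le_mul_of_nonneg_left e1 hN.le
    have e6 : √(n : ℝ) * (2 * (σ ^ 2) ^ 2 / n * (1 + Real.log n))
        = 2 * (σ ^ 2) ^ 2 * (1 / √n) * (1 + Real.log n) := by
      rw [← mul_assoc, e4]
    rw [e6] at e5
    set E := Real.exp (σ ^ 2 * (L ^ 2 * d) / 2) with hE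
    have e7 : 1 / (2 * (n : ℝ)) * (2 * n * E) = E := by field_simp
    rw [e7, e4]
    have hr : 0 < 1 / √(n : ℝ) := by positivity
    set r := 1 / √(n : ℝ) with hr'
    have hE0 : 0 < E := Real.exp_pos _
    have e8 : 2 * r * (Real.log (2 * n) + E) ≤ 2 * r * ((1 + Real.log n) + E) :=
      mul_le_mul_of_nonneg_left (by linarith) (by positivity)
    have p1 : 0 ≤ r * Real.log n := by positivity
    have p2 : 0 ≤ (σ ^ 2) ^ 2 * (r * Real.log n) := by positivity
    have p3 : 0 ≤ E * (r * Real.log n) := by positivity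
    have p4 : 0 ≤ (σ ^ 2) ^ 2 * r := by positivity
    nlinarith

end

/-! ### The balanced number of neighbours and the rate -/

section

/-- The power `1 / 10` of `n` that absorbs the logarithm is the gap between `1 / 2` and the rate
`2 / 5` in dimension three. -/
theorem log_div_sqrt_le_rate {d n : ℕ} (hd : 2 < d) (hn : 1 ≤ n) :
    1 / √(n : ℝ) * (1 + Real.log n) ≤ 11 * (n : ℝ) ^ (-(2 : ℝ) / (2 + (d : ℝ))) := by
  have hn0 : (0 : ℝ) < n := by exact_mod_cast hn
  have hn1 : (1 : ℝ) ≤ n := by exact_mod_cast hn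
  have h1 := Real.log_le_rpow_div hn0.le (by norm_num : (0 : ℝ) < 1 / 10)
  have h2 : (1 : ℝ) ≤ (n : ℝ) ^ (1 / 10 : ℝ) := Real.one_le_rpow hn1 (by norm_num)
  have h3 : 1 + Real.log n ≤ 11 * (n : ℝ) ^ (1 / 10 : ℝ) := by linarith
  have h4 : 1 / √(n : ℝ) = (n : ℝ) ^ (-(1 / 2) : ℝ) := by
    rw [Real.rpow_neg hn0.le, Real.sqrt_eq_rpow, one_div]
  have h5 : (n : ℝ) ^ (-(1 / 2) : ℝ) * (n : ℝ) ^ (1 / 10 : ℝ)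
      ≤ (n : ℝ) ^ (-(2 : ℝ) / (2 + (d : ℝ))) := by
    rw [← Real.rpow_add hn0]
    refine Real.rpow_le_rpow_of_exponent_le hn1 ?_
    have hd' : (3 : ℝ) ≤ d := by exact_mod_cast hd
    rw [le_div_iff₀ (by linarith)]
    linarith
  rw [h4]
  calc _ ≤ (n : ℝ) ^ (-(1 / 2) : ℝ) * (11 * (n : ℝ) ^ (1 / 10 : ℝ)) :=
        mul_le_mul_of_nonneg_left h3 (by positivity)
    _ ≤ _ := by linarith

/-- The number of neighbours that balances squared bias and variance, `k ≍ n ^ (2 / (2 + d))`,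
taken of the form `4 ^ (M - a)` where `2 ^ M ≍ n ^ (1 / (2 + d))`. The constant `a` makes the
squared bias small against the variance. When `M ≤ a`, truncated subtraction gives `k = 1`, for
which the bias vanishes. -/
theorem exists_balanced (d : ℕ) (hd : 2 < d) (σ : ℝ) (hσ : 0 < σ) (L : ℝ≥0) :
    ∃ C : ℝ, 0 < C ∧ ∀ (n : ℕ), 1 ≤ n → ∃ k : ℕ, 1 ≤ k ∧ k ≤ n ∧
      (∀ (x : Fin n → EuclideanSpace ℝ (Fin d)), (∀ i, x i ∈ cube d) →
        ∀ (f : EuclideanSpace ℝ (Fin d) → ℝ), LipschitzOnWith L f (cube d) → ∀ τ : Ties n,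
        empNormSq (biasVec x τ f k) ≤ σ ^ 2 / (100 * k)) ∧
      1 / (k : ℝ) ≤ C * (n : ℝ) ^ (-(2 : ℝ) / (2 + (d : ℝ))) ∧
      (k : ℝ) / n ≤ 4 * (n : ℝ) ^ (-(2 : ℝ) / (2 + (d : ℝ))) ∧
      Real.exp (-(n / (800 * k ^ 2))) ≤ 5120000 * (n : ℝ) ^ (-(2 : ℝ) / (2 + (d : ℝ))) := by
  obtain ⟨a, ha⟩ := pow_unbounded_of_one_lt (100 * (L ^ 2 * (d * (1 + 4 ^ d))) / σ ^ 2)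
    (by norm_num : (1 : ℝ) < 4)
  have hσ2 : 0 < σ ^ 2 := pow_pos hσ 2
  rw [div_lt_iff₀ hσ2] at ha
  refine ⟨4 ^ a * 4, by positivity, fun n hn => ?_⟩
  have hn0 : (0 : ℝ) < n := by exact_mod_cast hn
  set M := Nat.log (2 ^ (d + 2)) n with hM
  set P : ℝ := 2 ^ M with hP
  have hP1 : 1 ≤ P := one_le_pow₀ (by norm_num)
  have hP0 : 0 < P := by linarith
  have hbase : 1 < 2 ^ (d + 2) := Nat.one_lt_two_pow (by omega)
  have hlow : P ^ (d + 2) ≤ n := by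
    have h : (2 ^ (d + 2)) ^ M ≤ n := Nat.pow_log_le_self _ (by omega)
    rw [hP, ← pow_mul, mul_comm, pow_mul]
    exact_mod_cast h
  have hupp : (n : ℝ) ≤ (2 * P) ^ (d + 2) := by
    have h : n < (2 ^ (d + 2)) ^ (M + 1) := Nat.lt_pow_succ_log_self hbase _
    rw [hP, ← pow_succ', ← pow_mul, mul_comm, pow_mul]
    exact_mod_cast h.le
  have h5 : P ^ 5 ≤ n := (pow_le_pow_right₀ hP1 (by omega)).trans hlow
  have h4M : (4 : ℝ) ^ M = P ^ 2 := by
    rw [hP, ← pow_mul, mul_comm, pow_mul]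
    norm_num
  set rate : ℝ := (n : ℝ) ^ (-(2 : ℝ) / (2 + (d : ℝ))) with hrate
  have hw : 1 / P ^ 2 ≤ 4 * rate := by
    have h1 : (n : ℝ) ^ ((2 : ℝ) / (2 + d)) ≤ (2 * P) ^ 2 := by
      refine (Real.rpow_le_rpow hn0.le hupp (by positivity)).trans_eq ?_
      rw [← Real.rpow_natCast, ← Real.rpow_mul (by positivity), ← Real.rpow_natCast]
      congr 1
      push_cast
      field_simp
      ring
    have h2 : rate = ((n : ℝ) ^ ((2 : ℝ) / (2 + d)))⁻¹ := by
      rw [hrate, neg_div, Real.rpow_neg hn0.le]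
    have h3 : 0 < (n : ℝ) ^ ((2 : ℝ) / (2 + d)) := Real.rpow_pos_of_pos hn0 _
    rw [h2, ← div_eq_mul_inv, div_le_div_iff₀ (by positivity) h3]
    linarith
  set k : ℕ := 4 ^ (M - a) with hk
  have hk1 : 1 ≤ k := Nat.one_le_pow _ _ (by norm_num)
  have hk0 : (0 : ℝ) < k := by exact_mod_cast hk1
  have hkP : (k : ℝ) ≤ P ^ 2 := by
    rw [← h4M, hk]
    push_cast
    exact pow_le_pow_right₀ (by norm_num) (Nat.sub_le _ _)
  have hkn : k ≤ n := by
    have : (k : ℝ) ≤ n := hkP.trans ((pow_le_pow_right₀ hP1 (by norm_num)).trans h5)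
    exact_mod_cast this
  refine ⟨k, hk1, hkn, fun x hx f hf τ => ?_, ?_, ?_, ?_⟩
  · rcases le_or_gt M a with hMa | hMa
    · have hk_one : k = 1 := by rw [hk, Nat.sub_eq_zero_of_le hMa, pow_zero]
      rw [hk_one]
      simp only [empNormSq, biasVec_one]
      simp
      positivity
    · have hka : (k : ℝ) * 4 ^ a = P ^ 2 := by
        rw [← h4M, hk]
        push_cast
        rw [← pow_add, Nat.sub_add_cancel hMa.le]
      have hb := sum_sq_biasVec_le x τ hd hf hx hk1 hkn M
      have hq : (k : ℝ) * (4 ^ d * (2 ^ d / 4) ^ M) ≤ 4 ^ d * (n / P ^ 2) := by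
        have e : ((2 : ℝ) ^ d / 4) ^ M = P ^ d / P ^ 2 := by
          rw [div_pow, h4M, hP, ← pow_mul 2 d M, ← pow_mul 2 M d, mul_comm]
        have h1 : (k : ℝ) * P ^ d ≤ n :=
          calc (k : ℝ) * P ^ d ≤ P ^ 2 * P ^ d := by gcongr
            _ = P ^ (d + 2) := by ring
            _ ≤ n := hlow
        rw [e]
        calc (k : ℝ) * (4 ^ d * (P ^ d / P ^ 2)) = 4 ^ d * (k * P ^ d / P ^ 2) := by ring
          _ ≤ _ := by gcongr
      have hw4 : (1 / 4 : ℝ) ^ M = 1 / P ^ 2 := by rw [div_pow, one_pow, h4M]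
      rw [hw4] at hb
      have hb2 : ∑ i, biasVec x τ f k i ^ 2 ≤ n * (L ^ 2 * (d * (1 + 4 ^ d)) / P ^ 2) := by
        refine hb.trans ?_
        calc _ ≤ (L : ℝ) ^ 2 * (d * (n * (1 / P ^ 2) + 4 ^ d * (n / P ^ 2))) := by gcongr
          _ = _ := by ring
      rw [empNormSq, one_div_mul_eq_div, div_le_iff₀ hn0]
      refine hb2.trans ?_
      rw [mul_comm]
      refine mul_le_mul_of_nonneg_right ?_ hn0.le
      rw [div_le_div_iff₀ (by positivity) (by positivity), ← hka]
      calc _ = (100 * ((L : ℝ) ^ 2 * (d * (1 + 4 ^ d)))) * k := by ring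
        _ ≤ (4 ^ a * σ ^ 2) * k := by gcongr
        _ = _ := by ring
  · have h1 : (4 : ℝ) ^ M ≤ 4 ^ a * k := by
      rw [hk]
      push_cast
      rw [← pow_add]
      exact pow_le_pow_right₀ (by norm_num) (by omega)
    rw [h4M] at h1
    calc 1 / (k : ℝ) ≤ 4 ^ a * (1 / P ^ 2) := by
          rw [mul_one_div, div_le_div_iff₀ hk0 (by positivity)]
          linarith
      _ ≤ 4 ^ a * (4 * rate) := by gcongr
      _ = _ := by ring
  · refine le_trans ?_ hw
    rw [div_le_div_iff₀ hn0 (by positivity), one_mul]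
    calc (k : ℝ) * P ^ 2 ≤ P ^ 2 * P ^ 2 := by gcongr
      _ = P ^ 4 := by ring
      _ ≤ P ^ 5 := pow_le_pow_right₀ hP1 (by norm_num)
      _ ≤ n := h5
  · have hy : (0 : ℝ) < n / (800 * k ^ 2) := by positivity
    have h1 := Real.quadratic_le_exp_of_nonneg hy.le
    have h2 : ((n : ℝ) / (800 * k ^ 2)) ^ 2 / 2 ≤ Real.exp (n / (800 * k ^ 2)) := by linarith
    have h3 : P ^ 2 / 1280000 ≤ ((n : ℝ) / (800 * k ^ 2)) ^ 2 / 2 := by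
      have h4 : P / 800 ≤ (n : ℝ) / (800 * k ^ 2) := by
        rw [div_le_div_iff₀ (by norm_num) (by positivity)]
        have : P * k ^ 2 ≤ n :=
          calc P * (k : ℝ) ^ 2 ≤ P * (P ^ 2) ^ 2 := by gcongr
            _ = P ^ 5 := by ring
            _ ≤ n := h5
        linarith
      have := pow_le_pow_left₀ (by positivity) h4 2
      linarith
    rw [Real.exp_neg, inv_le_comm₀ (Real.exp_pos _) (by positivity)]
    refine le_trans ?_ (h3.trans h2)
    have h6 : 1 ≤ 4 * rate * P ^ 2 := by
      rwa [div_le_iff₀ (by positivity)] at hw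
    rw [inv_le_iff_one_le_mul₀ (by positivity)]
    linarith

end

end KNN

end

/-- The first bound averages over the noise and over independent uniformly random tie-breaking
orders; the second one, for pairwise distinct design points, holds for the expectation over the
noise alone, whatever the tie-breaking. -/
theorem corollary1 (d : ℕ) (hd : 2 < d) (σ : ℝ) (hσ : 0 < σ) (L : ℝ≥0) :
    ∃ c : ℝ, 0 < c ∧
      ∀ (n : ℕ), 1 ≤ n →
      ∀ (x : Fin n → EuclideanSpace ℝ (Fin d)), (∀ i, x i ∈ KNN.cube d) →
      ∀ (f : EuclideanSpace ℝ (Fin d) → ℝ), LipschitzOnWith L f (KNN.cube d) →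
        (∀ τ : KNN.Ties n, Integrable (KNN.loss x τ σ f) (KNN.noise n σ)) ∧
        (1 / (Fintype.card (KNN.Ties n) : ℝ)) *
            ∑ τ : KNN.Ties n, ∫ ε, KNN.loss x τ σ f ε ∂(KNN.noise n σ)
          ≤ c * (n : ℝ) ^ (-(2 : ℝ) / (2 + (d : ℝ))) ∧
        (Function.Injective x → ∀ τ : KNN.Ties n,
          ∫ ε, KNN.loss x τ σ f ε ∂(KNN.noise n σ)
            ≤ c * (n : ℝ) ^ (-(2 : ℝ) / (2 + (d : ℝ)))) := by
  obtain ⟨Γ, hΓ0, hΓ⟩ := KNN.exists_sum_reverseCount_sq_le d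
  obtain ⟨C, hC0, hC⟩ := KNN.exists_balanced d hd σ hσ L
  set K : ℝ := 6 + 3 * (σ ^ 2) ^ 2 + 2 * Real.exp (σ ^ 2 * (L ^ 2 * d) / 2) with hK
  have hK0 : 0 < K := by positivity
  refine ⟨K * 11 + 2 * σ ^ 2 * (C + 3216 + 5120000) + 100 * σ ^ 2 * Γ * 4, by positivity,
    fun n hn x hx f hf => ?_⟩
  obtain ⟨k, hk1, hkn, hb, hvar, hratio, hexp⟩ := hC n hn
  set rate : ℝ := (n : ℝ) ^ (-(2 : ℝ) / (2 + (d : ℝ)))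
  have hk0 : (0 : ℝ) < k := by exact_mod_cast hk1
  have hn0 : (0 : ℝ) < n := by exact_mod_cast hn
  set q : ℝ := 100 * σ ^ 2 / (k * n ^ 2) with hq
  have hq0 : 0 ≤ q := by positivity
  have hlog := mul_le_mul_of_nonneg_left (KNN.log_div_sqrt_le_rate hd hn) hK0.le
  have hloss : ∀ τ : KNN.Ties n, KNN.IntegralLE (KNN.noise n σ) (KNN.loss x τ σ f)
      ((K * 11 + 2 * σ ^ 2 * (C + 3216 + 5120000)) * rate
        + q * ∑ j, (KNN.reverseCount x τ k j : ℝ) ^ 2) := by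
    intro τ
    refine (KNN.integralLE_loss x τ f hσ hf hx hk1 hkn (hb x hx f hf τ)).weaken ?_
    have h1 : 1 / (k : ℝ) + 804 * (k / n) + Real.exp (-(n / (800 * k ^ 2)))
        ≤ (C + 3216 + 5120000) * rate := by linarith
    have h2 := mul_le_mul_of_nonneg_left h1 (by positivity : 0 ≤ 2 * σ ^ 2)
    have h3 : 2 * σ ^ 2 * (50 * (∑ j, (KNN.reverseCount x τ k j : ℝ) ^ 2) / (k * n ^ 2))
        = q * ∑ j, (KNN.reverseCount x τ k j : ℝ) ^ 2 := by
      rw [hq]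
      ring
    linarith
  have hcount : ∀ S : ℝ, S ≤ Γ * n * k ^ 2 → q * S ≤ 100 * σ ^ 2 * Γ * 4 * rate := by
    intro S hS
    calc q * S ≤ q * (Γ * n * k ^ 2) := mul_le_mul_of_nonneg_left hS hq0
      _ = 100 * σ ^ 2 * Γ * (k / n) := by
        rw [hq]
        field_simp
      _ ≤ 100 * σ ^ 2 * Γ * (4 * rate) := by gcongr
      _ = _ := by ring
  refine ⟨fun τ => (hloss τ).1, ?_, fun hinj τ => ?_⟩
  · have hcard : (0 : ℝ) < Fintype.card (KNN.Ties n) := by exact_mod_cast Fintype.card_pos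
    have h1 := Finset.sum_le_sum fun (τ : KNN.Ties n) (_ : τ ∈ Finset.univ) => (hloss τ).2
    rw [Finset.sum_add_distrib, Finset.sum_const, ← Finset.mul_sum, Finset.card_univ,
      nsmul_eq_mul] at h1
    have h2 := hcount _ (hΓ n x k hk1 hkn).1
    refine (mul_le_mul_of_nonneg_left h1 (by positivity)).trans ?_
    rw [mul_add, ← mul_assoc, one_div_mul_cancel hcard.ne', one_mul, mul_left_comm]
    linarith
  · have h1 := hcount _ ((hΓ n x k hk1 hkn).2 hinj τ)
    have h2 := (hloss τ).2
    linarith
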